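/- **Setting.** Let $T$ be the record type with pointer fields $\mathsf l,\mathsf r:\mathbf P(T)$ and boolean fields $\mathsf{chk},\mathsf{mk}$, and let $\mathsf{root},\mathsf t,\mathsf p,\mathsf q$ be program variables of type $\mathbf P(T)$. Distinct variables, distinct fields and distinct $T$-blocks occupy distinct memory units; dereferencing $\mathbf{nil}$ is undefined. The memory may contain arbitrary further units. Consider the program $\mathsf t:=\mathsf{root};\ \mathsf p:=\mathbf{nil};$ **while** $\big(\mathsf p\ne\mathbf{nil}\ ?\ \mathbf{true}:(\mathsf t=\mathbf{nil}\ ?\ \mathbf{false}:\neg\,\mathsf t\to\mathsf{mk})\big)$ **do** **if** $(\mathsf t=\mathbf{nil}\ ?\ \mathbf{true}:\mathsf t\to\mathsf{mk})$ **then** **if** $(\mathsf p\to\mathsf{chk})$ **then** $\mathsf q:=\mathsf t;\ \mathsf t:=\mathsf p;\ \mathsf p:=\mathsf p\to\mathsf r;\ \mathsf t\to\mathsf r:=\mathsf q$ **else** $\mathsf q:=\mathsf t;\ \mathsf t:=\mathsf p\to\mathsf r;\ \mathsf p\to\mathsf r:=\mathsf p\to\mathsf l;\ \mathsf p\to\mathsf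 l:=\mathsf q;\ \mathsf p\to\mathsf{chk}:=\mathbf{true}$ **else** $\mathsf q:=\mathsf p;\ \mathsf p:=\mathsf t;\ \mathsf t:=\mathsf t\to\mathsf l;\ \mathsf p\to\mathsf l:=\mathsf q;\ \mathsf p\to\mathsf{mk}:=\mathbf{true};\ \mathsf p\to\mathsf{chk}:=\mathbf{false}$. Let $r_0$ be a pointer to $T$ and $L_0,R_0$ maps from $T$-nodes to pointers. Let $NS_0$ be the smallest set of pointers that contains $r_0$ and, for each non-nil $x\in NS_0$, contains $L_0(x)$ if $L_0(x)\neq\mathbf{nil}$ and $R_0(x)$ if $R_0(x)\ne\mathbf{nil}$. Let $\mathrm{Block}(x)$ be the set of the four memory units of the node $x$ (empty for $\mathbf{nil}$) and $MSet=\{\&\mathsf p,\&\mathsf t,\&\mathsf q\}\cup\bigcup_{x\in NS_0}\mathrm{Block}(x)$. **Logic.** Formulas are formulas of the Logic for Partial Functions (three-valued) over terms built from constants, partial basic functions, memory access $\ast$, conditionals, bounded conjunctions and unions, recursively defined functions (least fixed points), and pre-state terms $\overleftarrow e$ (the value of $e$ in the initial state). The memory scope $\mathfrak M(\cdot)$,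 the set of memory units read during evaluation, is the term obtained syntactically by: $\mathfrak M=\emptyset$ for constants and pre-state terms; $\mathfrak M(\ast e)=\mathfrak M(e)\cup\{e\}$; $\mathfrak M(e_0?e_1:e_2)=\mathfrak M(e_0)\cup(e_0?\mathfrak M(e_1):\mathfrak M(e_2))$; for a basic function, the union of the scopes of the arguments; for a recursive $f(x)\triangleq e$, additionally $\mathfrak M(f)$ at the arguments, where $\mathfrak M(f)(x)\triangleq\mathfrak M(e)$; for formulas, the union over the constituents (for quantifiers and bounded conjunctions, over all instances). $\mathrm{Outlying}(\rho,e)$ abbreviates $\rho\wedge(\mathfrak M(\rho)\cap e=\emptyset)$. A triple $p\,\{s\}\,q$ is *valid* if $s$, started in a state satisfying $p$, never faults, and $q$ holds whenever $s$ halts. It is *derivable* if it follows by the rules of Scope Logic: the axioms for skip and assignment $$\mathrm{Outlying}(\rho,\{e_1\})\wedge e_1\neq\mathbf{nil}\wedge e_2{\downarrow}\ \{\ast e_1:=e_2\}\ \rho\wedge(\ast\overleftarrow{e_1}=\overleftarrow{e_2}),$$ the rules for if, while and sequential composition (in the latter two the assertions contain no pre-state term), interchange of $e$ and $\overleftarrow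 e$ in preconditions, consequence (with semantically valid implications), conjunction, disjunction, universal and existential quantification, and substitution of a denoting term for a logic variable. **Recursive functions.** $\mathsf{NextNode}(x)\triangleq(x=\mathbf{nil})?r_0:(x\to\mathsf{chk}?R_0(x):L_0(x))$; $\mathsf{Explored}(x)\triangleq(x=\mathbf{nil})?\mathbf{true}:x\to\mathsf{mk}$; $\mathsf{Stack}(x)\triangleq(x=\mathbf{nil})?[\,]:x^\frown\mathsf{Stack}(x\to\mathsf{chk}?x\to\mathsf r:x\to\mathsf l)$; $\mathsf{Acyclic}(s)$ says recursively that the head of $s$ does not occur in its tail; $\mathsf{InPath}(x)\triangleq x=\mathbf{nil}?\mathbf{true}:\ x\in NS_0\wedge x\to\mathsf{mk}=\mathbf{true}\wedge\big(x\to\mathsf{chk}\,?\,(\mathsf{NextNode}(x\to\mathsf r)=x\wedge x\to\mathsf l=L_0(x)\wedge\mathsf{Explored}(L_0(x))):(\mathsf{NextNode}(x\to\mathsf l)=x\wedge x\to\mathsf r=R_0(x))\big)\wedge\mathsf{InPath}(x\to\mathsf{chk}?x\to\mathsf r:x\to\mathsf l)$; $\mathsf{OutPath}(s)\triangleq\bigwedge_{y\in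 s}\big(y\to\mathsf l=L_0(y)\wedge y\to\mathsf r=R_0(y)\wedge(y\to\mathsf{mk}?(y\to\mathsf{chk}\wedge\mathsf{Explored}(L_0(y))\wedge\mathsf{Explored}(R_0(y))):\mathbf{true})\big)$. **Theorem.** For every predicate $\rho$ (possibly using further recursive functions), the specification $$\mathrm{Outlying}(\rho,MSet)\wedge\mathsf{root}=r_0\wedge\bigwedge_{x\in NS_0}\big(\neg x\to\mathsf{mk}\wedge\neg x\to\mathsf{chk}\wedge x\to\mathsf l=L_0(x)\wedge x\to\mathsf r=R_0(x)\big)$$ $$\{\text{the program}\}$$ $$\rho\wedge\bigwedge_{x\in NS_0}\big(x\to\mathsf{mk}\wedge x\to\mathsf{chk}\wedge x\to\mathsf l=L_0(x)\wedge x\to\mathsf r=R_0(x)\big)$$ is valid. If moreover $\rho$ contains no pre-state term, it is derivable in the logic, and the loop has the invariant $$\mathrm{SW\_INV}=\mathrm{Outlying}(\rho,MSet)\wedge\mathsf{Acyclic}(\mathsf{Stack}(\mathsf p))\wedge\mathsf{OutPath}(NS_0\setminus\mathrm{rng}(\mathsf{Stack}(\mathsf p)))\wedge\mathsf{InPath}(\mathsf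 p)\wedge\mathsf{NextNode}(\mathsf p)=\mathsf t,$$ that is: the triple from the precondition through the two initial assignments to $\mathrm{SW\_INV}$ is derivable; the triple from $\mathrm{SW\_INV}$ together with the loop condition through the loop body to $\mathrm{SW\_INV}$ is derivable; and $\mathrm{SW\_INV}$ together with the negated loop condition implies the postcondition. -/

import Mathlib

/-!
Scope Logic: a Hoare logic with partial (three-valued) formulas, recursive functions, memory
scopes and pre-state terms; and the Schorr-Waite marking program with its specification.
-/

namespace ScopeLogic

/-! ### Types, memory units, stores -/

/-- Types of values that fit in one memory unit.  `node` is the type `P(T)` of pointers to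
graph nodes, `ref τ` is the type of pointers to memory units of type `τ`; `other` ranges over
any further such types of the surrounding program. -/
inductive Ty (O : Type) : Type
  | int
  | bool
  | node
  | ref (τ : Ty O)
  | other (o : O)

/-- The field names of the record type `T = REC((l,P(T)) × (r,P(T)) × (chk,bool) × (mk,bool))`. -/
inductive Fld : Type
  | l
  | r
  | chk
  | mk

/-- The program variables of the Schorr-Waite program, all of type `P(T)`. -/
inductive Var : Type
  | root
  | t
  | p
  | q

/-- What a memory consists of: the memory blocks of type `T` (`Node`), and arbitrary further
memory units (`OUnit`; other variables and other heap data) with their types. -/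
structure World where
  Node : Type
  OTy : Type
  OVal : OTy → Type
  OUnit : Type
  oty : OUnit → Ty OTy

/-- The static type of a field of `T`. -/
@[reducible] def Fld.ty {O : Type} : Fld → Ty O
  | .l => .node
  | .r => .node
  | .chk => .bool
  | .mk => .bool

/-- Memory units: `&v`, `&x→n` for a block `x` of type `T`, and all other units. -/
inductive MUnit (W : World) : Type
  | var (v : Var)
  | fld (x : W.Node) (n : Fld)
  | other (u : W.OUnit)

/-- The type of the value stored in a memory unit. -/
@[reducible] def MUnit.ty {W : World} : MUnit W → Ty W.OTy
  | .var _ => .node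
  | .fld _ n => n.ty
  | .other u => W.oty u

/-- Pointers to nodes, type `P(T)`; `none` is **nil**. -/
abbrev NPtr (W : World) : Type := Option W.Node

/-- Values of each type; `none` is **nil** in pointer types. -/
@[reducible] def Val (W : World) : Ty W.OTy → Type
  | .int => ℤ
  | .bool => Bool
  | .node => NPtr W
  | .ref τ => Option {u : MUnit W // u.ty = τ}
  | .other o => W.OVal o

/-- A program state: the contents of all memory units. -/
abbrev Store (W : World) : Type := (u : MUnit W) → Val W u.ty

/-- The content of a unit of type `τ`. -/
def Store.get {W : World} {τ : Ty W.OTy} (σ : Store W) (c : {u : MUnit W // u.ty = τ}) :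
    Val W τ :=
  c.2 ▸ σ c.1

open Classical in
/-- The store after writing `v` into the unit `c`. -/
noncomputable def Store.set {W : World} {τ : Ty W.OTy} (σ : Store W)
    (c : {u : MUnit W // u.ty = τ}) (v : Val W τ) : Store W :=
  Function.update σ c.1 (c.2.symm ▸ v)

/-- The set of memory units of the block a node pointer refers to. -/
def Block {W : World} : NPtr W → Set (MUnit W)
  | none => ∅
  | some x => {u | ∃ n : Fld, u = .fld x n}

/-! ### Programs -/

/-- Program expressions.  `op f` applies a (partial) basic operation; constants and the
addresses `&v` are literals; `deref` is the memory access operator `∗`. -/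
inductive Expr (W : World) : Type → Type 1
  | lit {α : Type} (a : α) : Expr W α
  | op {α β : Type} (f : α → Option β) (e : Expr W α) : Expr W β
  | pair {α β : Type} (a : Expr W α) (b : Expr W β) : Expr W (α × β)
  | deref {τ : Ty W.OTy} (e : Expr W (Val W (.ref τ))) : Expr W (Val W τ)
  | cond {α : Type} (c : Expr W Bool) (a b : Expr W α) : Expr W α

/-- The value of a program expression, `none` if it is undefined. -/
def Expr.eval {W : World} (σ : Store W) : {α : Type} → Expr W α → Option α
  | _, .lit a => some a
  | _, .op f e => (e.eval σ).bind f
  | _, .pair a b => (a.eval σ).bind fun x => (b.eval σ).map fun y => (x, y)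
  | _, .deref e => (e.eval σ).bind fun c => c.map σ.get
  | _, .cond c a b => (c.eval σ).bind fun x => if x then a.eval σ else b.eval σ

/-- Program statements; `assign e₁ e₂` is `∗e₁ := e₂`. -/
inductive Stmt (W : World) : Type 1
  | skip
  | assign {τ : Ty W.OTy} (e₁ : Expr W (Val W (.ref τ))) (e₂ : Expr W (Val W τ))
  | seq (s₁ s₂ : Stmt W)
  | ite (e : Expr W Bool) (s₁ s₂ : Stmt W)
  | while (e : Expr W Bool) (s : Stmt W)

/-- Big-step semantics.  The outcome `some σ'` is normal termination in `σ'`; the outcome `none`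
is a run-time fault (an undefined expression or an assignment through **nil**). -/
inductive Exec {W : World} : Stmt W → Store W → Option (Store W) → Prop
  | skip (σ : Store W) : Exec .skip σ (some σ)
  | assign {τ : Ty W.OTy} {e₁ : Expr W (Val W (.ref τ))} {e₂ : Expr W (Val W τ)} {σ : Store W}
      {c : {u : MUnit W // u.ty = τ}} {v : Val W τ} :
      e₁.eval σ = some (some c) → e₂.eval σ = some v →
      Exec (.assign e₁ e₂) σ (some (σ.set c v))
  | assign_fault {τ : Ty W.OTy} {e₁ : Expr W (Val W (.ref τ))} {e₂ : Expr W (Val W τ)}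
      {σ : Store W} :
      (e₁.eval σ = none ∨ e₁.eval σ = some none ∨ e₂.eval σ = none) →
      Exec (.assign e₁ e₂) σ none
  | seq {s₁ s₂ : Stmt W} {σ σ₁ : Store W} {o : Option (Store W)} :
      Exec s₁ σ (some σ₁) → Exec s₂ σ₁ o → Exec (.seq s₁ s₂) σ o
  | seq_fault {s₁ s₂ : Stmt W} {σ : Store W} :
      Exec s₁ σ none → Exec (.seq s₁ s₂) σ none
  | ite_true {e : Expr W Bool} {s₁ s₂ : Stmt W} {σ : Store W} {o : Option (Store W)} :
      e.eval σ = some true → Exec s₁ σ o → Exec (.ite e s₁ s₂) σ o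
  | ite_false {e : Expr W Bool} {s₁ s₂ : Stmt W} {σ : Store W} {o : Option (Store W)} :
      e.eval σ = some false → Exec s₂ σ o → Exec (.ite e s₁ s₂) σ o
  | ite_fault {e : Expr W Bool} {s₁ s₂ : Stmt W} {σ : Store W} :
      e.eval σ = none → Exec (.ite e s₁ s₂) σ none
  | while_true {e : Expr W Bool} {s : Stmt W} {σ σ₁ : Store W} {o : Option (Store W)} :
      e.eval σ = some true → Exec s σ (some σ₁) → Exec (.while e s) σ₁ o →
      Exec (.while e s) σ o
  | while_body_fault {e : Expr W Bool} {s : Stmt W} {σ : Store W} :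
      e.eval σ = some true → Exec s σ none → Exec (.while e s) σ none
  | while_false {e : Expr W Bool} {s : Stmt W} {σ : Store W} :
      e.eval σ = some false → Exec (.while e s) σ (some σ)
  | while_fault {e : Expr W Bool} {s : Stmt W} {σ : Store W} :
      e.eval σ = none → Exec (.while e s) σ none

/-! ### Terms with recursive functions, and memory scopes -/

/-- The symbols for user-defined recursive functions, with argument and result types. -/
structure FunSig where
  Sym : Type
  Dom : Sym → Type
  Cod : Sym → Type

/-- Terms of the specification language.  Logic variables are represented by the values they
stand for (`lit`), and a term with a bound variable by a function into terms.
`call f e` is `f(e)`, `callScope f n e` is `𝔐ⁿ⁺¹(f)(e)` (the iterated memory scope function),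
`all s b` is `⋀_{y ∈ s} b(y)`, `iUnion s b` is `⋃_{y ∈ s} b(y)`, `pre e` is the pre-state term. -/
inductive Term (W : World) (S : FunSig) : Type → Type 1
  | lit {α : Type} (a : α) : Term W S α
  | op {α β : Type} (f : α → Option β) (e : Term W S α) : Term W S β
  | pair {α β : Type} (a : Term W S α) (b : Term W S β) : Term W S (α × β)
  | deref {τ : Ty W.OTy} (e : Term W S (Val W (.ref τ))) : Term W S (Val W τ)
  | cond {α : Type} (c : Term W S Bool) (a b : Term W S α) : Term W S α
  | and (a b : Term W S Bool) : Term W S Bool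
  | all {α : Type} (s : Term W S (Set α)) (b : α → Term W S Bool) : Term W S Bool
  | iUnion {α β : Type} (s : Term W S (Set α)) (b : α → Term W S (Set β)) : Term W S (Set β)
  | call (f : S.Sym) (e : Term W S (S.Dom f)) : Term W S (S.Cod f)
  | callScope (f : S.Sym) (n : ℕ) (e : Term W S (S.Dom f)) : Term W S (Set (MUnit W))
  | pre {α : Type} (e : Term W S α) : Term W S α

/-- Program expressions as terms. -/
def Expr.toTerm {W : World} (S : FunSig) : {α : Type} → Expr W α → Term W S α
  | _, .lit a => .lit a
  | _, .op f e => .op f (e.toTerm S)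
  | _, .pair a b => .pair (a.toTerm S) (b.toTerm S)
  | _, .deref e => .deref (e.toTerm S)
  | _, .cond c a b => .cond (c.toTerm S) (a.toTerm S) (b.toTerm S)

namespace Term

variable {W : World} {S : FunSig}

/-- The union of two set-valued terms. -/
def union {β : Type} (a b : Term W S (Set β)) : Term W S (Set β) :=
  .op (fun x : Set β × Set β => some (x.1 ∪ x.2)) (.pair a b)

/-- The set of memory units `{e}`, for a non-nil pointer `e` to a memory unit. -/
def unitSet {τ : Ty W.OTy} (e : Term W S (Val W (.ref τ))) : Term W S (Set (MUnit W)) :=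
  .op (fun x : Val W (.ref τ) => x.map fun c => ({c.1} : Set (MUnit W))) e

open Classical in
/-- Equality as a boolean-valued basic function. -/
noncomputable def eqb {α : Type} (a b : Term W S α) : Term W S Bool :=
  .op (fun x : α × α => some (decide (x.1 = x.2))) (.pair a b)

/-- Boolean negation. -/
def neg (a : Term W S Bool) : Term W S Bool := .op (fun x => some (!x)) a

/-- The memory scope form `𝔐(e)` of a term. -/
def scope : {α : Type} → Term W S α → Term W S (Set (MUnit W))
  | _, .lit _ => .lit ∅
  | _, .op _ e => e.scope
  | _, .pair a b => a.scope.union b.scope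
  | _, .deref e => e.scope.union (unitSet e)
  | _, .cond c a b => c.scope.union (.cond c a.scope b.scope)
  | _, .and a b => a.scope.union b.scope
  | _, .all s b => s.scope.union (.iUnion s fun y => (b y).scope)
  | _, .iUnion s b => s.scope.union (.iUnion s fun y => (b y).scope)
  | _, .call f e => e.scope.union (.callScope f 0 e)
  | _, .callScope f n e => e.scope.union (.callScope f (n + 1) e)
  | _, .pre _ => .lit ∅

/-- `𝔐ⁿ⁺¹(e)`. -/
def scopeIter {α : Type} (e : Term W S α) : ℕ → Term W S (Set (MUnit W))
  | 0 => e.scope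
  | n + 1 => (e.scopeIter n).scope

/-- The term contains no pre-state term. -/
def NoPre : {α : Type} → Term W S α → Prop
  | _, .lit _ => True
  | _, .op _ e => e.NoPre
  | _, .pair a b => a.NoPre ∧ b.NoPre
  | _, .deref e => e.NoPre
  | _, .cond c a b => c.NoPre ∧ a.NoPre ∧ b.NoPre
  | _, .and a b => a.NoPre ∧ b.NoPre
  | _, .all s b => s.NoPre ∧ ∀ y, (b y).NoPre
  | _, .iUnion s b => s.NoPre ∧ ∀ y, (b y).NoPre
  | _, .call _ e => e.NoPre
  | _, .callScope _ _ e => e.NoPre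
  | _, .pre _ => False

/-- The term with each pre-state term replaced by its original form. -/
def bar : {α : Type} → Term W S α → Term W S α
  | _, .lit a => .lit a
  | _, .op f e => .op f e.bar
  | _, .pair a b => .pair a.bar b.bar
  | _, .deref e => .deref e.bar
  | _, .cond c a b => .cond c.bar a.bar b.bar
  | _, .and a b => .and a.bar b.bar
  | _, .all s b => .all s.bar fun y => (b y).bar
  | _, .iUnion s b => .iUnion s.bar fun y => (b y).bar
  | _, .call f e => .call f e.bar
  | _, .callScope f n e => .callScope f n e.bar
  | _, .pre e => e.bar

end Term

/-- A system of (mutually) recursive function definitions `f(x) ≜ body f x`. -/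
structure FunDefs (W : World) (S : FunSig) where
  body : (f : S.Sym) → S.Dom f → Term W S (S.Cod f)
  noPre : ∀ f x, (body f x).NoPre

/-- `Eval D σ₀ σ e v`: with pre-state `σ₀` and current state `σ`, the term `e` is defined and has
the value `v` (least-fixed-point semantics of the recursive definitions).  Conjunctions are those
of the Logic for Partial Functions: false as soon as one conjunct is false. -/
inductive Eval {W : World} {S : FunSig} (D : FunDefs W S) (σ₀ : Store W) :
    Store W → {α : Type} → Term W S α → α → Prop
  | lit {σ : Store W} {α : Type} (a : α) : Eval D σ₀ σ (.lit a) a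
  | op {σ : Store W} {α β : Type} {f : α → Option β} {e : Term W S α} {x : α} {y : β} :
      Eval D σ₀ σ e x → f x = some y → Eval D σ₀ σ (.op f e) y
  | pair {σ : Store W} {α β : Type} {a : Term W S α} {b : Term W S β} {x : α} {y : β} :
      Eval D σ₀ σ a x → Eval D σ₀ σ b y → Eval D σ₀ σ (.pair a b) (x, y)
  | deref {σ : Store W} {τ : Ty W.OTy} {e : Term W S (Val W (.ref τ))}
      {c : {u : MUnit W // u.ty = τ}} :
      Eval D σ₀ σ e (some c) → Eval D σ₀ σ (.deref e) (σ.get c)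
  | cond_true {σ : Store W} {α : Type} {c : Term W S Bool} {a b : Term W S α} {x : α} :
      Eval D σ₀ σ c true → Eval D σ₀ σ a x → Eval D σ₀ σ (.cond c a b) x
  | cond_false {σ : Store W} {α : Type} {c : Term W S Bool} {a b : Term W S α} {x : α} :
      Eval D σ₀ σ c false → Eval D σ₀ σ b x → Eval D σ₀ σ (.cond c a b) x
  | and_true {σ : Store W} {a b : Term W S Bool} :
      Eval D σ₀ σ a true → Eval D σ₀ σ b true → Eval D σ₀ σ (.and a b) true
  | and_false_left {σ : Store W} {a b : Term W S Bool} :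
      Eval D σ₀ σ a false → Eval D σ₀ σ (.and a b) false
  | and_false_right {σ : Store W} {a b : Term W S Bool} :
      Eval D σ₀ σ b false → Eval D σ₀ σ (.and a b) false
  | all_true {σ : Store W} {α : Type} {s : Term W S (Set α)} {b : α → Term W S Bool} {X : Set α} :
      Eval D σ₀ σ s X → (∀ y ∈ X, Eval D σ₀ σ (b y) true) → Eval D σ₀ σ (.all s b) true
  | all_false {σ : Store W} {α : Type} {s : Term W S (Set α)} {b : α → Term W S Bool} {X : Set α}
      {y : α} :
      Eval D σ₀ σ s X → y ∈ X → Eval D σ₀ σ (b y) false → Eval D σ₀ σ (.all s b) false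
  | iUnion {σ : Store W} {α β : Type} {s : Term W S (Set α)} {b : α → Term W S (Set β)}
      {X : Set α} {F : α → Set β} :
      Eval D σ₀ σ s X → (∀ y ∈ X, Eval D σ₀ σ (b y) (F y)) →
      Eval D σ₀ σ (.iUnion s b) (⋃ y ∈ X, F y)
  | call {σ : Store W} {f : S.Sym} {e : Term W S (S.Dom f)} {x : S.Dom f} {y : S.Cod f} :
      Eval D σ₀ σ e x → Eval D σ₀ σ (D.body f x) y → Eval D σ₀ σ (.call f e) y
  | callScope {σ : Store W} {f : S.Sym} {n : ℕ} {e : Term W S (S.Dom f)} {x : S.Dom f}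
      {y : Set (MUnit W)} :
      Eval D σ₀ σ e x → Eval D σ₀ σ ((D.body f x).scopeIter n) y →
      Eval D σ₀ σ (.callScope f n e) y
  | pre {σ : Store W} {α : Type} {e : Term W S α} {x : α} :
      Eval D σ₀ σ₀ e x → Eval D σ₀ σ (.pre e) x

/-! ### Formulas -/

/-- Formulas of the Logic for Partial Functions over the terms above; `seq` is strong
equivalence `==` and `dfn e` is `e↓`. -/
inductive Formula (W : World) (S : FunSig) : Type 1
  | tm (e : Term W S Bool)
  | eq {α : Type} (a b : Term W S α)
  | seq {α : Type} (a b : Term W S α)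
  | dfn {α : Type} (e : Term W S α)
  | and (p q : Formula W S)
  | not (p : Formula W S)
  | all {α : Type} (p : α → Formula W S)

namespace Formula

variable {W : World} {S : FunSig}

/-- Disjunction, defined from conjunction and negation. -/
def or (p q : Formula W S) : Formula W S := .not (.and (.not p) (.not q))

/-- Existential quantification, defined from universal quantification and negation. -/
def ex {α : Type} (p : α → Formula W S) : Formula W S := .not (.all fun x => .not (p x))

/-- The memory scope `𝔐(p)` of a formula. -/
def scope : Formula W S → Term W S (Set (MUnit W))
  | .tm e => e.scope
  | .eq a b => a.scope.union b.scope
  | .seq a b => a.scope.union b.scope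
  | .dfn e => e.scope
  | .and p q => p.scope.union q.scope
  | .not p => p.scope
  | .all p => .iUnion (.lit Set.univ) fun x => (p x).scope

/-- The formula contains no pre-state term. -/
def NoPre : Formula W S → Prop
  | .tm e => e.NoPre
  | .eq a b => a.NoPre ∧ b.NoPre
  | .seq a b => a.NoPre ∧ b.NoPre
  | .dfn e => e.NoPre
  | .and p q => p.NoPre ∧ q.NoPre
  | .not p => p.NoPre
  | .all p => ∀ x, (p x).NoPre

/-- The formula with each pre-state term replaced by its original form. -/
def bar : Formula W S → Formula W S
  | .tm e => .tm e.bar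
  | .eq a b => .eq a.bar b.bar
  | .seq a b => .seq a.bar b.bar
  | .dfn e => .dfn e.bar
  | .and p q => .and p.bar q.bar
  | .not p => .not p.bar
  | .all p => .all fun x => (p x).bar

/-- `p.Is D σ₀ σ v`: the formula is denoting and has the truth value `v`. -/
def Is (D : FunDefs W S) (σ₀ σ : Store W) : Formula W S → Bool → Prop
  | .tm e, v => Eval D σ₀ σ e v
  | .eq a b, v => ∃ x y, Eval D σ₀ σ a x ∧ Eval D σ₀ σ b y ∧ (x = y ↔ v = true)
  | .seq a b, v => (∀ x, Eval D σ₀ σ a x ↔ Eval D σ₀ σ b x) ↔ v = true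
  | .dfn e, v => (∃ x, Eval D σ₀ σ e x) ↔ v = true
  | .and p q, true => p.Is D σ₀ σ true ∧ q.Is D σ₀ σ true
  | .and p q, false => p.Is D σ₀ σ false ∨ q.Is D σ₀ σ false
  | .not p, v => p.Is D σ₀ σ (!v)
  | .all p, true => ∀ x, (p x).Is D σ₀ σ true
  | .all p, false => ∃ x, (p x).Is D σ₀ σ false

/-- The formula is true (in particular, denoting) for pre-state `σ₀` and current state `σ`. -/
def Holds (D : FunDefs W S) (p : Formula W S) (σ₀ σ : Store W) : Prop := p.Is D σ₀ σ true

/-- `𝔐(ρ) ∩ e = ∅`. -/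
def disjointScope (ρ : Formula W S) (e : Term W S (Set (MUnit W))) : Formula W S :=
  .eq (.op (fun x : Set (MUnit W) × Set (MUnit W) => some (x.1 ∩ x.2)) (.pair ρ.scope e)) (.lit ∅)

/-- `Outlying(ρ, e)`, i.e. `ρ ∧ (𝔐(ρ) ∩ e = ∅)`. -/
def outlying (ρ : Formula W S) (e : Term W S (Set (MUnit W))) : Formula W S :=
  .and ρ (disjointScope ρ e)

/-- `p[e/x]`, for a formula `p` with the logic variable `x` and a denoting term `e`. -/
def subst {α : Type} (p : α → Formula W S) (e : Term W S α) : Formula W S :=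
  .ex fun a => .and (.eq e (.lit a)) (p a)

end Formula

/-- `p ⇒ q` is valid. -/
def Entails {W : World} {S : FunSig} (D : FunDefs W S) (p q : Formula W S) : Prop :=
  ∀ σ₀ σ : Store W, p.Holds D σ₀ σ → q.Holds D σ₀ σ

/-! ### Specifications `p {s} q` -/

/-- Validity of `p {s} q`: started in a state satisfying `p`, the statement does not fault, and
whenever it halts, `q` holds (its pre-state terms being evaluated in the initial state). -/
def Valid {W : World} {S : FunSig} (D : FunDefs W S)
    (p : Formula W S) (s : Stmt W) (q : Formula W S) : Prop :=
  ∀ σ : Store W, p.Holds D σ σ →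
    ∀ o : Option (Store W), Exec s σ o → ∃ σ' : Store W, o = some σ' ∧ q.Holds D σ σ'

/-- Derivability of `p {s} q` by the axioms and proof rules of the logic. -/
inductive Provable {W : World} {S : FunSig} (D : FunDefs W S) :
    Formula W S → Stmt W → Formula W S → Prop
  | skip_st (q : Formula W S) : Provable D q .skip q
  | assign_st {τ : Ty W.OTy} (ρ : Formula W S)
      (e₁ : Expr W (Val W (.ref τ))) (e₂ : Expr W (Val W τ)) :
      Provable D
        (.and (ρ.outlying (Term.unitSet (e₁.toTerm S)))
          (.and (.not (.eq (e₁.toTerm S) (.lit none))) (.dfn (e₂.toTerm S))))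
        (.assign e₁ e₂)
        (.and ρ (.eq (.deref (.pre (e₁.toTerm S))) (.pre (e₂.toTerm S))))
  | if_st {p q : Formula W S} {e : Expr W Bool} {s₁ s₂ : Stmt W} :
      Provable D (.and p (.tm (e.toTerm S))) s₁ q →
      Provable D (.and p (.not (.tm (e.toTerm S)))) s₂ q →
      Provable D (.and p (.or (.tm (e.toTerm S)) (.not (.tm (e.toTerm S))))) (.ite e s₁ s₂) q
  | while_st {p : Formula W S} {e : Expr W Bool} {s : Stmt W} :
      p.NoPre →
      Provable D (.and p (.tm (e.toTerm S))) s
        (.and p (.or (.tm (e.toTerm S)) (.not (.tm (e.toTerm S))))) →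
      Provable D (.and p (.or (.tm (e.toTerm S)) (.not (.tm (e.toTerm S))))) (.while e s)
        (.and (.not (.tm (e.toTerm S))) p)
  | seq_st {p q r : Formula W S} {s₁ s₂ : Stmt W} :
      p.NoPre → q.NoPre → r.NoPre →
      Provable D p s₁ q → Provable D q s₂ r → Provable D p (.seq s₁ s₂) r
  | pre_1 {p q : Formula W S} {s : Stmt W} : Provable D p.bar s q → Provable D p s q
  | pre_2 {p q : Formula W S} {s : Stmt W} : Provable D p s q → Provable D p.bar s q
  | conseq {p p' q q' : Formula W S} {s : Stmt W} :
      Provable D p s q → Entails D p' p → Entails D q q' → Provable D p' s q'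
  | conjunction {p p' q q' : Formula W S} {s : Stmt W} :
      Provable D p s q → Provable D p' s q' → Provable D (.and p p') s (.and q q')
  | disjunction {p p' q q' : Formula W S} {s : Stmt W} :
      Provable D p s q → Provable D p' s q' → Provable D (.or p p') s (.or q q')
  | all {α : Type} [Nonempty α] {p q : α → Formula W S} {s : Stmt W} :
      (∀ x, Provable D (p x) s (q x)) → Provable D (.all p) s (.all q)
  | exist {α : Type} {p q : α → Formula W S} {s : Stmt W} :
      (∀ x, Provable D (p x) s (q x)) → Provable D (.ex p) s (.ex q)
  | substitution {α : Type} {p q : α → Formula W S} {s : Stmt W} {e : Term W S α} :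
      e.NoPre → (∀ x, Provable D (p x) s (q x)) → (∀ x, Entails D (p x) (.dfn e)) →
      Provable D (Formula.subst p e) s (Formula.subst q (.pre e))

/-! ### The Schorr-Waite program -/

namespace SW

/-- `&v`. -/
def varRef (W : World) (v : Var) : Val W (.ref .node) := some ⟨.var v, rfl⟩

/-- `&x→n`, undefined for `x = nil`. -/
def fldRef (W : World) (n : Fld) (x : NPtr W) : Option (Val W (.ref n.ty)) :=
  x.map fun a => some ⟨.fld a n, rfl⟩

section Program

variable {W : World}

/-- The expression `v`, i.e. `∗(&v)`. -/
def var (v : Var) : Expr W (NPtr W) := .deref (τ := .node) (.lit (varRef W v))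

/-- The expression `e→n`, i.e. `∗(&e→n)`. -/
def fld (e : Expr W (NPtr W)) (n : Fld) : Expr W (Val W n.ty) :=
  .deref (τ := n.ty) (.op (fldRef W n) e)

/-- `e = nil`. -/
def isNil (e : Expr W (NPtr W)) : Expr W Bool := .op (fun x => some x.isNone) e

/-- Boolean negation. -/
def neg (e : Expr W Bool) : Expr W Bool := .op (fun x => some (!x)) e

/-- `v := e`. -/
def setVar (v : Var) (e : Expr W (NPtr W)) : Stmt W :=
  .assign (τ := .node) (.lit (varRef W v)) e

/-- `v→n := e`. -/
def setFld (v : Var) (n : Fld) (e : Expr W (Val W n.ty)) : Stmt W :=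
  .assign (τ := n.ty) (.op (fldRef W n) (var v)) e

/-- `p ≠ nil ? true : ((t = nil) ? false : ¬ t→mk)`. -/
def condWh : Expr W Bool :=
  .cond (neg (isNil (var .p))) (.lit true)
    (.cond (isNil (var .t)) (.lit false) (neg (fld (var .t) .mk)))

/-- `t = nil ? true : t→mk`. -/
def cond1 : Expr W Bool := .cond (isNil (var .t)) (.lit true) (fld (var .t) .mk)

/-- `p→chk`. -/
def cond2 : Expr W Bool := fld (var .p) .chk

/-- `t := root; p := nil`. -/
def initCode : Stmt W := .seq (setVar .t (var .root)) (setVar .p (.lit none))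

/-- `q := t; t := p; p := p→r; t→r := q`. -/
def popCode : Stmt W :=
  .seq (setVar .q (var .t)) <| .seq (setVar .t (var .p)) <|
  .seq (setVar .p (fld (var .p) .r)) (setFld .t .r (var .q))

/-- `q := t; t := p→r; p→r := p→l; p→l := q; p→chk := true`. -/
def tryRightCode : Stmt W :=
  .seq (setVar .q (var .t)) <| .seq (setVar .t (fld (var .p) .r)) <|
  .seq (setFld .p .r (fld (var .p) .l)) <| .seq (setFld .p .l (var .q))
    (setFld .p .chk (.lit true))

/-- `q := p; p := t; t := t→l; p→l := q; p→mk := true; p→chk := false`. -/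
def pushCode : Stmt W :=
  .seq (setVar .q (var .p)) <| .seq (setVar .p (var .t)) <|
  .seq (setVar .t (fld (var .t) .l)) <| .seq (setFld .p .l (var .q)) <|
  .seq (setFld .p .mk (.lit true)) (setFld .p .chk (.lit false))

/-- The body of the loop. -/
def loopBody : Stmt W := .ite cond1 (.ite cond2 popCode tryRightCode) pushCode

/-- The Schorr-Waite program. -/
def program : Stmt W := .seq initCode (.while condWh loopBody)

end Program

/-! ### The recursive functions, the invariant and the specification -/

/-- The original graph: starting pointer `r₀` and edge maps `L₀`, `R₀`. -/
structure Graph (W : World) where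
  r₀ : NPtr W
  L₀ : W.Node → NPtr W
  R₀ : W.Node → NPtr W

/-- `NS₀`, the smallest set that contains `r₀` and is closed under the non-nil edges. -/
inductive Graph.Reach {W : World} (G : Graph W) : NPtr W → Prop
  | start : G.Reach G.r₀
  | left {x : W.Node} : G.Reach (some x) → G.L₀ x ≠ none → G.Reach (G.L₀ x)
  | right {x : W.Node} : G.Reach (some x) → G.R₀ x ≠ none → G.Reach (G.R₀ x)

/-- `NS₀` as a set. -/
def Graph.NS₀ {W : World} (G : Graph W) : Set (NPtr W) := {x | G.Reach x}

/-- Names of the recursive functions of the proof, together with any further function symbols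
`U` of the user. -/
inductive Sym (U : FunSig) : Type
  | NextNode
  | Explored
  | Stack
  | isAcyclic
  | InPath
  | OutPath
  | user (f : U.Sym)

/-- Argument types. -/
@[reducible] def Sym.Dom (W : World) {U : FunSig} : Sym U → Type
  | .NextNode => NPtr W
  | .Explored => NPtr W
  | .Stack => NPtr W
  | .isAcyclic => List (NPtr W)
  | .InPath => NPtr W
  | .OutPath => Set (NPtr W)
  | .user f => U.Dom f

/-- Result types. -/
@[reducible] def Sym.Cod (W : World) {U : FunSig} : Sym U → Type
  | .NextNode => NPtr W
  | .Explored => Bool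
  | .Stack => List (NPtr W)
  | .isAcyclic => Bool
  | .InPath => Bool
  | .OutPath => Bool
  | .user f => U.Cod f

/-- The function symbols available in formulas. -/
@[reducible] def sig (W : World) (U : FunSig) : FunSig := ⟨Sym U, Sym.Dom W, Sym.Cod W⟩

section Spec

variable {W : World} {U : FunSig}

/-- Terms over the function symbols. -/
abbrev Tm (W : World) (U : FunSig) (α : Type) : Type 1 := Term W (sig W U) α

/-- The term `v`. -/
def tvar (v : Var) : Tm W U (NPtr W) := .deref (τ := .node) (.lit (varRef W v))

/-- The term `e→n`. -/
def tfld (e : Tm W U (NPtr W)) (n : Fld) : Tm W U (Val W n.ty) :=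
  .deref (τ := n.ty) (.op (fldRef W n) e)

/-- The term `e = nil`. -/
def tnil (e : Tm W U (NPtr W)) : Tm W U Bool := .op (fun x => some x.isNone) e

/-- The term `L₀(e)`, undefined for `e = nil`. -/
def tL (G : Graph W) (e : Tm W U (NPtr W)) : Tm W U (NPtr W) := .op (fun x => x.map G.L₀) e

/-- The term `R₀(e)`, undefined for `e = nil`. -/
def tR (G : Graph W) (e : Tm W U (NPtr W)) : Tm W U (NPtr W) := .op (fun x => x.map G.R₀) e

/-- `NextNode(e)`. -/
def nextNode (e : Tm W U (NPtr W)) : Tm W U (NPtr W) := .call (S := sig W U) .NextNode e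

/-- `Explored(e)`. -/
def explored (e : Tm W U (NPtr W)) : Tm W U Bool := .call (S := sig W U) .Explored e

/-- `Stack(e)`. -/
def stack (e : Tm W U (NPtr W)) : Tm W U (List (NPtr W)) := .call (S := sig W U) .Stack e

/-- `isAcyclic(e)`. -/
def acyclic (e : Tm W U (List (NPtr W))) : Tm W U Bool := .call (S := sig W U) .isAcyclic e

/-- `InPath(e)`. -/
def inPath (e : Tm W U (NPtr W)) : Tm W U Bool := .call (S := sig W U) .InPath e

/-- `OutPath(e)`. -/
def outPath (e : Tm W U (Set (NPtr W))) : Tm W U Bool := .call (S := sig W U) .OutPath e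

/-- `NextNode(x) ≜ (x = nil) ? r₀ : (x→chk ? R₀(x) : L₀(x))`. -/
def nextNodeBody (G : Graph W) (x : NPtr W) : Tm W U (NPtr W) :=
  .cond (tnil (.lit x)) (.lit G.r₀)
    (.cond (tfld (.lit x) .chk) (tR G (.lit x)) (tL G (.lit x)))

/-- `Explored(x) ≜ (x = nil) ? true : x→mk`. -/
def exploredBody (x : NPtr W) : Tm W U Bool :=
  .cond (tnil (.lit x)) (.lit true) (tfld (.lit x) .mk)

/-- The link `x→chk ? x→r : x→l` to the rest of the path. -/
def link (x : NPtr W) : Tm W U (NPtr W) :=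
  .cond (tfld (.lit x) .chk) (tfld (.lit x) .r) (tfld (.lit x) .l)

/-- `Stack(x) ≜ (x = nil) ? [] : x ⌢ Stack(x→chk ? x→r : x→l)`. -/
def stackBody (x : NPtr W) : Tm W U (List (NPtr W)) :=
  .cond (tnil (.lit x)) (.lit []) (.op (fun s => some (x :: s)) (stack (link x)))

open Classical in
/-- `isAcyclic(s) ≜ (s = []) ? true : head(s) ∉ rng(tail(s)) ∧ isAcyclic(tail(s))`. -/
noncomputable def isAcyclicBody : List (NPtr W) → Tm W U Bool
  | [] => .lit true
  | a :: s => .and (.lit (decide (a ∉ s))) (acyclic (.lit s))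

open Classical in
/-- The definition of `InPath(x)`. -/
noncomputable def inPathBody (G : Graph W) (x : NPtr W) : Tm W U Bool :=
  .cond (tnil (.lit x)) (.lit true) <|
    .and (.lit (decide (x ∈ G.NS₀))) <|
    .and (.eqb (tfld (.lit x) .mk) (.lit true)) <|
    .and
      (.cond (tfld (.lit x) .chk)
        (.and (.eqb (nextNode (tfld (.lit x) .r)) (.lit x)) <|
          .and (.eqb (tfld (.lit x) .l) (tL G (.lit x))) (explored (tL G (.lit x))))
        (.and (.eqb (nextNode (tfld (.lit x) .l)) (.lit x))
          (.eqb (tfld (.lit x) .r) (tR G (.lit x)))))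
      (inPath (link x))

/-- The definition of `OutPath(s)`. -/
noncomputable def outPathBody (G : Graph W) (s : Set (NPtr W)) : Tm W U Bool :=
  .all (.lit s) fun y =>
    .and (.eqb (tfld (.lit y) .l) (tL G (.lit y))) <|
    .and (.eqb (tfld (.lit y) .r) (tR G (.lit y)))
      (.cond (tfld (.lit y) .mk)
        (.and (tfld (.lit y) .chk) <| .and (explored (tL G (.lit y))) (explored (tR G (.lit y))))
        (.lit true))

/-- The recursive definitions of the proof, together with the user's definitions. -/
noncomputable def body (G : Graph W) (ub : (f : U.Sym) → U.Dom f → Tm W U (U.Cod f)) :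
    (f : Sym U) → Sym.Dom W f → Tm W U (Sym.Cod W f)
  | .NextNode, x => nextNodeBody G x
  | .Explored, x => exploredBody x
  | .Stack, x => stackBody x
  | .isAcyclic, s => isAcyclicBody s
  | .InPath, x => inPathBody G x
  | .OutPath, s => outPathBody G s
  | .user f, x => ub f x

theorem body_noPre (G : Graph W) (ub : (f : U.Sym) → U.Dom f → Tm W U (U.Cod f))
    (hub : ∀ f x, (ub f x).NoPre) (f : Sym U) (x : Sym.Dom W f) : (body G ub f x).NoPre := by
  cases f with
  | user f => exact hub f x
  | isAcyclic => cases x <;> simp [body, isAcyclicBody, Term.NoPre, acyclic]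
  | _ =>
    simp [body, nextNodeBody, exploredBody, stackBody, inPathBody, outPathBody, Term.NoPre, tnil,
      tfld, tL, tR, stack, link, Term.eqb, nextNode, explored, inPath]

/-- All function definitions. -/
noncomputable def defs (G : Graph W) (ub : (f : U.Sym) → U.Dom f → Tm W U (U.Cod f))
    (hub : ∀ f x, (ub f x).NoPre) : FunDefs W (sig W U) :=
  ⟨body G ub, body_noPre G ub hub⟩

/-- `MSet = {&p, &t, &q} ∪ ⋃_{x ∈ NS₀} Block(x)`. -/
def MSet (G : Graph W) : Set (MUnit W) :=
  {.var .p, .var .t, .var .q} ∪ ⋃ x ∈ G.NS₀, Block x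

/-- `⋀_{x ∈ NS₀} (¬ x→mk ∧ ¬ x→chk ∧ x→l = L₀(x) ∧ x→r = R₀(x))`. -/
noncomputable def unmarked (G : Graph W) : Formula W (sig W U) :=
  .tm <| .all (.lit G.NS₀) fun x =>
    .and (.neg (tfld (.lit x) .mk)) <| .and (.neg (tfld (.lit x) .chk)) <|
    .and (.eqb (tfld (.lit x) .l) (tL G (.lit x))) (.eqb (tfld (.lit x) .r) (tR G (.lit x)))

/-- `⋀_{x ∈ NS₀} (x→mk ∧ x→chk ∧ x→l = L₀(x) ∧ x→r = R₀(x))`. -/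
noncomputable def marked (G : Graph W) : Formula W (sig W U) :=
  .tm <| .all (.lit G.NS₀) fun x =>
    .and (tfld (.lit x) .mk) <| .and (tfld (.lit x) .chk) <|
    .and (.eqb (tfld (.lit x) .l) (tL G (.lit x))) (.eqb (tfld (.lit x) .r) (tR G (.lit x)))

/-- The precondition. -/
noncomputable def preCond (G : Graph W) (ρ : Formula W (sig W U)) : Formula W (sig W U) :=
  .and (ρ.outlying (.lit (MSet G))) <| .and (.eq (tvar .root) (.lit G.r₀)) (unmarked G)

/-- The postcondition. -/
noncomputable def postCond (G : Graph W) (ρ : Formula W (sig W U)) : Formula W (sig W U) :=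
  .and ρ (marked G)

/-- The loop invariant `SW_INV`. -/
def inv (G : Graph W) (ρ : Formula W (sig W U)) : Formula W (sig W U) :=
  .and (ρ.outlying (.lit (MSet G))) <|
  .and (.tm (acyclic (stack (tvar .p)))) <|
  .and (.tm (outPath (.op (fun s : List (NPtr W) => some (G.NS₀ \ {y | y ∈ s}))
    (stack (tvar .p))))) <|
  .and (.tm (inPath (tvar .p)))
    (.eq (nextNode (tvar .p)) (tvar .t))

end Spec

end SW

end ScopeLogic

/-! Two independent facts are combined.

The first concerns the logic: every valid triple without pre-state terms is derivable
(`Valid.provable`). Quantifiers over values let a formula describe any set of stores exactly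
(`Formula.ofPred`), so weakest preconditions are expressible and serve as intermediate assertions
and loop invariants (`Provable.of_ensures`). All derivability claims thus reduce to validity.

The second is the correctness of the program, argued on stores through `IsInv`. The links from `p`
to nil form a duplicate-free list of marked nodes. Each of these has one edge missing, but it is
recoverable: for the top node it leads to `t`, for a deeper node to the node above it. Off the list
all fields are original, and the successors of marked nodes are explored. The branches of the body
retract the path (`IsInv.pop`), turn its top node from the left to the right edge (`IsInv.tryRight`)
or extend it (`IsInv.push`). On exit the path is empty and `t` is the explored root, so the marked
nodes contain the root and are closed under edges (`IsInv.marked_of_exit`). `holds_inv_iff`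
identifies `SW_INV` with `IsInv` together with `Outlying`.

The predicate `ρ` survives because the program writes only into `MSet`, and the truth value and
scope of a formula depend only on the units in that scope (`Formula.congr_of_scope`). With recursive
functions this frame property needs an induction on the evaluation of the scope, organised by
`ScopeFramed`. -/

namespace ScopeLogic

/-! ### Evaluation of terms: inversion and uniqueness of values. -/

section Metatheory

variable {W : World} {S : FunSig} {D : FunDefs W S} {σ₀ σ σ' : Store W}

/-- The premises from which a term can be evaluated, by the shape of the term. -/
def EvalPremise (D : FunDefs W S) (σ₀ σ : Store W) : {α : Type} → Term W S α → α → Prop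
  | _, .lit a, v => v = a
  | _, .op f e, v => ∃ x, Eval D σ₀ σ e x ∧ f x = some v
  | _, .pair a b, v => Eval D σ₀ σ a v.1 ∧ Eval D σ₀ σ b v.2
  | _, .deref e, v => ∃ c, Eval D σ₀ σ e (some c) ∧ v = σ.get c
  | _, .cond c a b, v =>
      (Eval D σ₀ σ c true ∧ Eval D σ₀ σ a v) ∨ (Eval D σ₀ σ c false ∧ Eval D σ₀ σ b v)
  | _, .and a b, v => (v = true ∧ Eval D σ₀ σ a true ∧ Eval D σ₀ σ b true) ∨
      (v = false ∧ (Eval D σ₀ σ a false ∨ Eval D σ₀ σ b false))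
  | _, .all s b, v => ∃ X, Eval D σ₀ σ s X ∧
      ((v = true ∧ ∀ y ∈ X, Eval D σ₀ σ (b y) true) ∨
        (v = false ∧ ∃ y ∈ X, Eval D σ₀ σ (b y) false))
  | _, .iUnion (α := A) (β := B) s b, v => ∃ (X : Set A) (F : A → Set B), Eval D σ₀ σ s X ∧
      (∀ y ∈ X, Eval D σ₀ σ (b y) (F y)) ∧
      v = ⋃ y ∈ X, F y
  | _, .call f e, v => ∃ x, Eval D σ₀ σ e x ∧ Eval D σ₀ σ (D.body f x) v
  | _, .callScope f n e, v => ∃ x, Eval D σ₀ σ e x ∧ Eval D σ₀ σ ((D.body f x).scopeIter n) v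
  | _, .pre e, v => Eval D σ₀ σ₀ e v

/-- Inversion is carried out once, for a variable term and value; the rule for each constructor is
then an instance by unfolding `EvalPremise`. -/
theorem eval_iff_premise {α : Type} {e : Term W S α} {v : α} :
    Eval D σ₀ σ e v ↔ EvalPremise D σ₀ σ e v := by
  constructor
  · intro h
    cases h with
    | lit => rfl
    | op h h' => exact ⟨_, h, h'⟩
    | pair h h' => exact ⟨h, h'⟩
    | deref h => exact ⟨_, h, rfl⟩
    | cond_true h h' => exact .inl ⟨h, h'⟩
    | cond_false h h' => exact .inr ⟨h, h'⟩
    | and_true h h' => exact .inl ⟨rfl, h, h'⟩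
    | and_false_left h => exact .inr ⟨rfl, .inl h⟩
    | and_false_right h => exact .inr ⟨rfl, .inr h⟩
    | all_true h h' => exact ⟨_, h, .inl ⟨rfl, h'⟩⟩
    | all_false h hy h' => exact ⟨_, h, .inr ⟨rfl, _, hy, h'⟩⟩
    | iUnion h h' => exact ⟨_, _, h, h', rfl⟩
    | call h h' => exact ⟨_, h, h'⟩
    | callScope h h' => exact ⟨_, h, h'⟩
    | pre h => exact h
  · intro h
    cases e <;> simp only [EvalPremise] at h
    case lit => subst h; exact .lit _
    case op => obtain ⟨x, h, h'⟩ := h; exact .op h h'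
    case pair => exact .pair h.1 h.2
    case deref => obtain ⟨c, h, rfl⟩ := h; exact .deref h
    case cond =>
      obtain ⟨h, h'⟩ | ⟨h, h'⟩ := h
      · exact .cond_true h h'
      · exact .cond_false h h'
    case and =>
      obtain ⟨rfl, h, h'⟩ | ⟨rfl, h | h⟩ := h
      · exact .and_true h h'
      · exact .and_false_left h
      · exact .and_false_right h
    case all =>
      obtain ⟨X, h, ⟨rfl, h'⟩ | ⟨rfl, y, hy, h'⟩⟩ := h
      · exact .all_true h h'
      · exact .all_false h hy h'
    case iUnion => obtain ⟨X, F, h, h', rfl⟩ := h; exact .iUnion h h'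
    case call => obtain ⟨x, h, h'⟩ := h; exact .call h h'
    case callScope => obtain ⟨x, h, h'⟩ := h; exact .callScope h h'
    case pre => exact .pre h

@[simp] theorem eval_lit {α : Type} {a v : α} :
    Eval D σ₀ σ (.lit a) v ↔ v = a := eval_iff_premise

@[simp] theorem eval_op {α β : Type} {f : α → Option β} {e : Term W S α} {v : β} :
    Eval D σ₀ σ (.op f e) v ↔ ∃ x, Eval D σ₀ σ e x ∧ f x = some v := eval_iff_premise

@[simp] theorem eval_pair {α β : Type} {a : Term W S α} {b : Term W S β} {v : α × β} :
    Eval D σ₀ σ (.pair a b) v ↔ Eval D σ₀ σ a v.1 ∧ Eval D σ₀ σ b v.2 := eval_iff_premise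

@[simp] theorem eval_deref {τ : Ty W.OTy} {e : Term W S (Val W (.ref τ))} {v : Val W τ} :
    Eval D σ₀ σ (.deref e) v ↔ ∃ c, Eval D σ₀ σ e (some c) ∧ v = σ.get c := eval_iff_premise

@[simp] theorem eval_cond {α : Type} {c : Term W S Bool} {a b : Term W S α} {v : α} :
    Eval D σ₀ σ (.cond c a b) v ↔
      (Eval D σ₀ σ c true ∧ Eval D σ₀ σ a v) ∨ (Eval D σ₀ σ c false ∧ Eval D σ₀ σ b v) :=
  eval_iff_premise

theorem eval_and {a b : Term W S Bool} {v : Bool} :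
    Eval D σ₀ σ (.and a b) v ↔ (v = true ∧ Eval D σ₀ σ a true ∧ Eval D σ₀ σ b true) ∨
      (v = false ∧ (Eval D σ₀ σ a false ∨ Eval D σ₀ σ b false)) := eval_iff_premise

@[simp] theorem eval_and_true {a b : Term W S Bool} :
    Eval D σ₀ σ (.and a b) true ↔ Eval D σ₀ σ a true ∧ Eval D σ₀ σ b true := by
  simp [eval_and]

theorem eval_all {α : Type} {s : Term W S (Set α)} {b : α → Term W S Bool} {v : Bool} :
    Eval D σ₀ σ (.all s b) v ↔ ∃ X, Eval D σ₀ σ s X ∧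
      ((v = true ∧ ∀ y ∈ X, Eval D σ₀ σ (b y) true) ∨
        (v = false ∧ ∃ y ∈ X, Eval D σ₀ σ (b y) false)) := eval_iff_premise

@[simp] theorem eval_all_true {α : Type} {s : Term W S (Set α)} {b : α → Term W S Bool} :
    Eval D σ₀ σ (.all s b) true ↔
      ∃ X, Eval D σ₀ σ s X ∧ ∀ y ∈ X, Eval D σ₀ σ (b y) true := by
  simp [eval_all]

theorem eval_iUnion {α β : Type} {s : Term W S (Set α)} {b : α → Term W S (Set β)}
    {v : Set β} :
    Eval D σ₀ σ (.iUnion s b) v ↔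
      ∃ (X : Set α) (F : α → Set β),
        Eval D σ₀ σ s X ∧ (∀ y ∈ X, Eval D σ₀ σ (b y) (F y)) ∧ v = ⋃ y ∈ X, F y :=
  eval_iff_premise

theorem eval_call {f : S.Sym} {e : Term W S (S.Dom f)} {v : S.Cod f} :
    Eval D σ₀ σ (.call f e) v ↔ ∃ x, Eval D σ₀ σ e x ∧ Eval D σ₀ σ (D.body f x) v :=
  eval_iff_premise

theorem eval_callScope {f : S.Sym} {n : ℕ} {e : Term W S (S.Dom f)} {v : Set (MUnit W)} :
    Eval D σ₀ σ (.callScope f n e) v ↔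
      ∃ x, Eval D σ₀ σ e x ∧ Eval D σ₀ σ ((D.body f x).scopeIter n) v := eval_iff_premise

@[simp] theorem eval_pre {α : Type} {e : Term W S α} {v : α} :
    Eval D σ₀ σ (.pre e) v ↔ Eval D σ₀ σ₀ e v := eval_iff_premise

@[simp] theorem eval_union {β : Type} {a b : Term W S (Set β)} {v : Set β} :
    Eval D σ₀ σ (a.union b) v ↔
      ∃ X Y, Eval D σ₀ σ a X ∧ Eval D σ₀ σ b Y ∧ v = X ∪ Y := by
  simp [Term.union, and_assoc, eq_comm]

theorem eval_unitSet {τ : Ty W.OTy} {e : Term W S (Val W (.ref τ))} {v : Set (MUnit W)} :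
    Eval D σ₀ σ (Term.unitSet e) v ↔ ∃ c, Eval D σ₀ σ e (some c) ∧ v = {c.1} := by
  simp only [Term.unitSet, eval_op]
  constructor
  · rintro ⟨_ | c, h, h'⟩
    · cases h'
    · exact ⟨c, h, (Option.some.inj h').symm⟩
  · rintro ⟨c, h, rfl⟩
    exact ⟨some c, h, rfl⟩

@[simp] theorem eval_eqb_true {α : Type} {a b : Term W S α} :
    Eval D σ₀ σ (.eqb a b) true ↔ ∃ x, Eval D σ₀ σ a x ∧ Eval D σ₀ σ b x := by
  simp [Term.eqb]

/-- The only overlapping rules are those of the non-strict conjunctions. They agree, because `true`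
requires every conjunct to be true, while `false` requires some conjunct to be false. -/
theorem Eval.unique {α : Type} {e : Term W S α} {v w : α} (h : Eval D σ₀ σ e v)
    (h' : Eval D σ₀ σ e w) : v = w := by
  induction h with
  | lit a => exact (eval_lit.1 h').symm
  | op _ hf ih =>
    obtain ⟨x, hx, hf'⟩ := eval_op.1 h'
    cases ih hx
    simpa [hf] using hf'
  | pair _ _ ih₁ ih₂ =>
    obtain ⟨h₁, h₂⟩ := eval_pair.1 h'
    exact Prod.ext (ih₁ h₁) (ih₂ h₂)
  | deref _ ih =>
    obtain ⟨c, hc, rfl⟩ := eval_deref.1 h'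
    cases ih hc
    rfl
  | cond_true _ _ ih₁ ih₂ =>
    obtain ⟨h₁, h₂⟩ | ⟨h₁, h₂⟩ := eval_cond.1 h'
    · exact ih₂ h₂
    · cases ih₁ h₁
  | cond_false _ _ ih₁ ih₂ =>
    obtain ⟨h₁, h₂⟩ | ⟨h₁, h₂⟩ := eval_cond.1 h'
    · cases ih₁ h₁
    · exact ih₂ h₂
  | and_true _ _ ih₁ ih₂ =>
    obtain ⟨h, -⟩ | ⟨-, h | h⟩ := eval_and.1 h'
    · exact h.symm
    · cases ih₁ h
    · cases ih₂ h
  | and_false_left _ ih =>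
    obtain ⟨-, h, -⟩ | ⟨h, -⟩ := eval_and.1 h'
    · cases ih h
    · exact h.symm
  | and_false_right _ ih =>
    obtain ⟨-, -, h⟩ | ⟨h, -⟩ := eval_and.1 h'
    · cases ih h
    · exact h.symm
  | all_true _ _ ih₁ ih₂ =>
    obtain ⟨X, hX, ⟨h, -⟩ | ⟨-, y, hy, h⟩⟩ := eval_all.1 h'
    · exact h.symm
    · cases ih₁ hX
      cases ih₂ y hy h
  | all_false _ hy _ ih₁ ih₂ =>
    obtain ⟨X, hX, ⟨-, h⟩ | ⟨h, -⟩⟩ := eval_all.1 h'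
    · cases ih₁ hX
      cases ih₂ (h _ hy)
    · exact h.symm
  | iUnion _ _ ih₁ ih₂ =>
    obtain ⟨X, F, hX, hF, rfl⟩ := eval_iUnion.1 h'
    cases ih₁ hX
    exact Set.iUnion₂_congr fun y hy => ih₂ y hy (hF y hy)
  | call _ _ ih₁ ih₂ =>
    obtain ⟨x, hx, h⟩ := eval_call.1 h'
    cases ih₁ hx
    exact ih₂ h
  | callScope _ _ ih₁ ih₂ =>
    obtain ⟨x, hx, h⟩ := eval_callScope.1 h'
    cases ih₁ hx
    exact ih₂ h
  | pre _ ih => exact ih (eval_pre.1 h')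

/-! ### Terms without pre-state terms -/

theorem Term.NoPre.scope {α : Type} {e : Term W S α} (h : e.NoPre) : e.scope.NoPre := by
  induction e <;> simp_all [Term.NoPre, Term.scope, Term.union, Term.unitSet]

theorem Term.NoPre.scopeIter {α : Type} {e : Term W S α} (h : e.NoPre) (n : ℕ) :
    (e.scopeIter n).NoPre := by
  induction n with
  | zero => exact h.scope
  | succ n ih => exact ih.scope

theorem Formula.NoPre.scope {p : Formula W S} (h : p.NoPre) : p.scope.NoPre := by
  induction p with
  | tm e => exact Term.NoPre.scope h
  | eq a b => exact ⟨Term.NoPre.scope h.1, Term.NoPre.scope h.2⟩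
  | seq a b => exact ⟨Term.NoPre.scope h.1, Term.NoPre.scope h.2⟩
  | dfn e => exact Term.NoPre.scope h
  | and p q ihp ihq => exact ⟨ihp h.1, ihq h.2⟩
  | not p ih => exact ih h
  | all p ih => exact ⟨trivial, fun x => ih x (h x)⟩

/-- Only the rule `pre` consults `σ₀`. Unfolding a recursive function does not lead to it, since
function bodies, and hence their iterated scopes, contain no pre-state term. -/
theorem Eval.change_pre {α : Type} {e : Term W S α} {v : α} (h : Eval D σ₀ σ e v)
    (hn : e.NoPre) (σ₁ : Store W) : Eval D σ₁ σ e v := by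
  induction h with
  | lit a => exact .lit a
  | op _ hf ih => exact .op (ih hn) hf
  | pair _ _ ih₁ ih₂ => exact .pair (ih₁ hn.1) (ih₂ hn.2)
  | deref _ ih => exact .deref (ih hn)
  | cond_true _ _ ih₁ ih₂ => exact .cond_true (ih₁ hn.1) (ih₂ hn.2.1)
  | cond_false _ _ ih₁ ih₂ => exact .cond_false (ih₁ hn.1) (ih₂ hn.2.2)
  | and_true _ _ ih₁ ih₂ => exact .and_true (ih₁ hn.1) (ih₂ hn.2)
  | and_false_left _ ih => exact .and_false_left (ih hn.1)
  | and_false_right _ ih => exact .and_false_right (ih hn.2)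
  | all_true _ _ ih₁ ih₂ => exact .all_true (ih₁ hn.1) fun y hy => ih₂ y hy (hn.2 y)
  | all_false _ hy _ ih₁ ih₂ => exact .all_false (ih₁ hn.1) hy (ih₂ (hn.2 _))
  | iUnion _ _ ih₁ ih₂ => exact .iUnion (ih₁ hn.1) fun y hy => ih₂ y hy (hn.2 y)
  | call _ _ ih₁ ih₂ => exact .call (ih₁ hn) (ih₂ (D.noPre _ _))
  | callScope _ _ ih₁ ih₂ => exact .callScope (ih₁ hn) (ih₂ ((D.noPre _ _).scopeIter _))
  | pre _ _ => exact hn.elim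

theorem Term.NoPre.eval_iff {α : Type} {e : Term W S α} (hn : e.NoPre) (σ₀ σ₁ : Store W)
    {v : α} : Eval D σ₀ σ e v ↔ Eval D σ₁ σ e v :=
  ⟨fun h => h.change_pre hn σ₁, fun h => h.change_pre hn σ₀⟩

theorem Formula.NoPre.is_iff {p : Formula W S} (hn : p.NoPre) (σ₀ σ₁ : Store W) (v : Bool) :
    p.Is D σ₀ σ v ↔ p.Is D σ₁ σ v := by
  induction p generalizing v with
  | tm e => exact Term.NoPre.eval_iff hn _ _
  | eq a b =>
    simp only [Formula.Is, Term.NoPre.eval_iff hn.1 σ₀ σ₁, Term.NoPre.eval_iff hn.2 σ₀ σ₁]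
  | seq a b =>
    simp only [Formula.Is, Term.NoPre.eval_iff hn.1 σ₀ σ₁, Term.NoPre.eval_iff hn.2 σ₀ σ₁]
  | dfn e => simp only [Formula.Is, Term.NoPre.eval_iff hn σ₀ σ₁]
  | and p q ihp ihq => cases v <;> simp only [Formula.Is, ihp hn.1, ihq hn.2]
  | not p ih => exact ih hn _
  | all p ih => cases v <;> simp only [Formula.Is, ih _ (hn _)]

/-- A pre-state term and its original form agree once the pre-state is the current state. `bar`
leaves function bodies alone, so the call cases change the pre-state under a body, which is harmless
by `noPre`. -/
theorem eval_bar {α : Type} {e : Term W S α} {v : α} :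
    Eval D σ₀ σ e.bar v ↔ Eval D σ σ e v := by
  induction e with
  | lit a => simp only [Term.bar, eval_lit]
  | op f e ih => simp only [Term.bar, eval_op, ih]
  | pair a b iha ihb => simp only [Term.bar, eval_pair, iha, ihb]
  | deref e ih => simp only [Term.bar, eval_deref, ih]
  | cond c a b ihc iha ihb => simp only [Term.bar, eval_cond, ihc, iha, ihb]
  | and a b iha ihb => simp only [Term.bar, eval_and, iha, ihb]
  | all s b ihs ihb => simp only [Term.bar, eval_all, ihs, ihb]
  | iUnion s b ihs ihb => simp only [Term.bar, eval_iUnion, ihs, ihb]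
  | call f e ih => simp only [Term.bar, eval_call, ih, (D.noPre _ _).eval_iff σ₀ σ]
  | callScope f n e ih =>
    simp only [Term.bar, eval_callScope, ih, ((D.noPre _ _).scopeIter _).eval_iff σ₀ σ]
  | pre e ih => simp only [Term.bar, eval_pre, ih]

theorem Formula.is_bar {p : Formula W S} {v : Bool} :
    p.bar.Is D σ₀ σ v ↔ p.Is D σ σ v := by
  induction p generalizing v with
  | tm e => exact eval_bar
  | eq a b => simp only [Formula.bar, Formula.Is, eval_bar]
  | seq a b => simp only [Formula.bar, Formula.Is, eval_bar]
  | dfn e => simp only [Formula.bar, Formula.Is, eval_bar]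
  | and p q ihp ihq => cases v <;> simp only [Formula.bar, Formula.Is, ihp, ihq]
  | not p ih => exact ih
  | all p ih => cases v <;> simp only [Formula.bar, Formula.Is, ih]

/-! ### Memory scopes: a term only depends on the units in its scope -/

/-- The value and the scope `X` of `e` do not change with the memory outside `X`. -/
def FramedBy (D : FunDefs W S) (σ₀ σ : Store W) {α : Type} (e : Term W S α)
    (X : Set (MUnit W)) : Prop :=
  ∀ σ' : Store W, (∀ u ∈ X, σ' u = σ u) →
    (∀ v, Eval D σ₀ σ e v → Eval D σ₀ σ' e v) ∧ Eval D σ₀ σ' e.scope X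

/-- Evaluation of a term whose scope functions are replaced by sets with the property `FramedBy`
of the function bodies. -/
def ScopeFramed (D : FunDefs W S) (σ₀ σ : Store W) : {α : Type} → Term W S α → α → Prop
  | _, .op f e, v => ∃ x, Eval D σ₀ σ e x ∧ ScopeFramed D σ₀ σ e x ∧ f x = some v
  | _, .pair a b, v => ScopeFramed D σ₀ σ a v.1 ∧ ScopeFramed D σ₀ σ b v.2
  | _, .cond c a b, v => (Eval D σ₀ σ c true ∧ ScopeFramed D σ₀ σ a v) ∨
      (Eval D σ₀ σ c false ∧ ScopeFramed D σ₀ σ b v)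
  | _, .iUnion (α := A) (β := B) s b, v => ∃ (X : Set A) (F : A → Set B), Eval D σ₀ σ s X ∧
      (∀ y ∈ X, ScopeFramed D σ₀ σ (b y) (F y)) ∧ v = ⋃ y ∈ X, F y
  | _, .callScope f 0 e, v => ∃ x, Eval D σ₀ σ e x ∧ FramedBy D σ₀ σ (D.body f x) v
  | _, .callScope f (n + 1) e, v =>
      ∃ x, Eval D σ₀ σ e x ∧ FramedBy D σ₀ σ ((D.body f x).scopeIter n) v
  | _, e, v => Eval D σ₀ σ e v

theorem ScopeFramed.of_union {β : Type} {a b : Term W S (Set β)} {v : Set β}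
    (h : ScopeFramed D σ₀ σ (a.union b) v) :
    ∃ X Y, ScopeFramed D σ₀ σ a X ∧ ScopeFramed D σ₀ σ b Y ∧ v = X ∪ Y := by
  obtain ⟨⟨X, Y⟩, -, ⟨hX, hY⟩, h⟩ := h
  exact ⟨X, Y, hX, hY, (Option.some.inj h).symm⟩

theorem Store.get_congr {τ : Ty W.OTy} {c : {u : MUnit W // u.ty = τ}} (h : σ' c.1 = σ c.1) :
    σ'.get c = σ.get c := by
  simp [Store.get, h]

/-- Structural induction on `e`: agreement on a union of scopes gives agreement on each part, so
arguments, guards and index sets keep their values. At a call the relevant body is not a subterm of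
`e`; there `ScopeFramed` already contains the frame property of the body. -/
theorem ScopeFramed.framedBy {α : Type} {e : Term W S α} {X : Set (MUnit W)}
    (h : ScopeFramed D σ₀ σ e.scope X) : FramedBy D σ₀ σ e X := by
  induction e generalizing X with
  | lit a => exact fun σ' _ => ⟨fun v hv => by simpa using hv, by simpa [Term.scope] using
      (eval_lit.1 h)⟩
  | op f e ih =>
    intro σ' hσ
    obtain ⟨h₁, h₂⟩ := ih h σ' hσ
    refine ⟨fun v hv => ?_, h₂⟩
    obtain ⟨x, hx, hv⟩ := eval_op.1 hv
    exact .op (h₁ x hx) hv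
  | pair a b iha ihb =>
    obtain ⟨A, B, hA, hB, rfl⟩ := h.of_union
    intro σ' hσ
    obtain ⟨ha₁, ha₂⟩ := iha hA σ' fun u hu => hσ u (.inl hu)
    obtain ⟨hb₁, hb₂⟩ := ihb hB σ' fun u hu => hσ u (.inr hu)
    refine ⟨fun v hv => ?_, eval_union.2 ⟨A, B, ha₂, hb₂, rfl⟩⟩
    obtain ⟨h, h'⟩ := eval_pair.1 hv
    exact .pair (ha₁ _ h) (hb₁ _ h')
  | deref e ih =>
    obtain ⟨A, B, hA, ⟨x, hx, -, hB⟩, rfl⟩ := h.of_union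
    intro σ' hσ
    obtain ⟨h₁, h₂⟩ := ih hA σ' fun u hu => hσ u (.inl hu)
    refine ⟨fun v hv => ?_, eval_union.2 ⟨A, B, h₂, .op (h₁ _ hx) hB, rfl⟩⟩
    obtain ⟨c, hc, rfl⟩ := eval_deref.1 hv
    cases hx.unique hc
    cases hB
    -- The scope of `∗e` contains the unit read, so its content is the same in both stores.
    rw [← Store.get_congr (hσ c.1 (.inr rfl))]
    exact .deref (h₁ _ hc)
  | cond c a b ihc iha ihb =>
    obtain ⟨A, B, hA, hB, rfl⟩ := h.of_union
    intro σ' hσ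
    obtain ⟨hc₁, hc₂⟩ := ihc hA σ' fun u hu => hσ u (.inl hu)
    obtain ⟨hc, hB⟩ | ⟨hc, hB⟩ := hB
    · obtain ⟨h₁, h₂⟩ := iha hB σ' fun u hu => hσ u (.inr hu)
      refine ⟨fun v hv => ?_, eval_union.2 ⟨A, B, hc₂, .cond_true (hc₁ _ hc) h₂, rfl⟩⟩
      obtain ⟨-, hv⟩ | ⟨hc', -⟩ := eval_cond.1 hv
      · exact .cond_true (hc₁ _ hc) (h₁ _ hv)
      · cases hc.unique hc'
    · obtain ⟨h₁, h₂⟩ := ihb hB σ' fun u hu => hσ u (.inr hu)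
      refine ⟨fun v hv => ?_, eval_union.2 ⟨A, B, hc₂, .cond_false (hc₁ _ hc) h₂, rfl⟩⟩
      obtain ⟨hc', -⟩ | ⟨-, hv⟩ := eval_cond.1 hv
      · cases hc.unique hc'
      · exact .cond_false (hc₁ _ hc) (h₁ _ hv)
  | and a b iha ihb =>
    obtain ⟨A, B, hA, hB, rfl⟩ := h.of_union
    intro σ' hσ
    obtain ⟨ha₁, ha₂⟩ := iha hA σ' fun u hu => hσ u (.inl hu)
    obtain ⟨hb₁, hb₂⟩ := ihb hB σ' fun u hu => hσ u (.inr hu)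
    refine ⟨fun v hv => ?_, eval_union.2 ⟨A, B, ha₂, hb₂, rfl⟩⟩
    obtain ⟨rfl, h, h'⟩ | ⟨rfl, h | h⟩ := eval_and.1 hv
    · exact .and_true (ha₁ _ h) (hb₁ _ h')
    · exact .and_false_left (ha₁ _ h)
    · exact .and_false_right (hb₁ _ h)
  | all s b ihs ihb =>
    obtain ⟨A, B, hA, ⟨Y, F, hY, hF, rfl⟩, rfl⟩ := h.of_union
    intro σ' hσ
    obtain ⟨hs₁, hs₂⟩ := ihs hA σ' fun u hu => hσ u (.inl hu)
    have hb := fun y hy => ihb y (hF y hy) σ' fun u hu =>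
      hσ u (.inr (Set.mem_biUnion hy hu))
    refine ⟨fun v hv => ?_, eval_union.2 ⟨A, _, hs₂,
      .iUnion (hs₁ _ hY) fun y hy => (hb y hy).2, rfl⟩⟩
    obtain ⟨Z, hZ, h⟩ := eval_all.1 hv
    cases hY.unique hZ
    obtain ⟨rfl, h⟩ | ⟨rfl, y, hy, h⟩ := h
    · exact .all_true (hs₁ _ hY) fun y hy => (hb y hy).1 _ (h y hy)
    · exact .all_false (hs₁ _ hY) hy ((hb y hy).1 _ h)
  | iUnion s b ihs ihb =>
    obtain ⟨A, B, hA, ⟨Y, F, hY, hF, rfl⟩, rfl⟩ := h.of_union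
    intro σ' hσ
    obtain ⟨hs₁, hs₂⟩ := ihs hA σ' fun u hu => hσ u (.inl hu)
    have hb := fun y hy => ihb y (hF y hy) σ' fun u hu =>
      hσ u (.inr (Set.mem_biUnion hy hu))
    refine ⟨fun v hv => ?_, eval_union.2 ⟨A, _, hs₂,
      .iUnion (hs₁ _ hY) fun y hy => (hb y hy).2, rfl⟩⟩
    obtain ⟨Z, F', hZ, h, rfl⟩ := eval_iUnion.1 hv
    cases hY.unique hZ
    exact .iUnion (hs₁ _ hY) fun y hy => (hb y hy).1 _ (h y hy)
  | call f e ih =>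
    obtain ⟨A, B, hA, ⟨x, hx, hB⟩, rfl⟩ := h.of_union
    intro σ' hσ
    obtain ⟨h₁, h₂⟩ := ih hA σ' fun u hu => hσ u (.inl hu)
    obtain ⟨hb₁, hb₂⟩ := hB σ' fun u hu => hσ u (.inr hu)
    refine ⟨fun v hv => ?_, eval_union.2 ⟨A, B, h₂, .callScope (h₁ _ hx) hb₂, rfl⟩⟩
    obtain ⟨y, hy, hv⟩ := eval_call.1 hv
    cases hx.unique hy
    exact .call (h₁ _ hx) (hb₁ _ hv)
  | callScope f n e ih =>
    obtain ⟨A, B, hA, ⟨x, hx, hB⟩, rfl⟩ := h.of_union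
    intro σ' hσ
    obtain ⟨h₁, h₂⟩ := ih hA σ' fun u hu => hσ u (.inl hu)
    obtain ⟨hb₁, hb₂⟩ := hB σ' fun u hu => hσ u (.inr hu)
    refine ⟨fun v hv => ?_, eval_union.2 ⟨A, B, h₂, .callScope (h₁ _ hx) hb₂, rfl⟩⟩
    obtain ⟨y, hy, hv⟩ := eval_callScope.1 hv
    cases hx.unique hy
    exact .callScope (h₁ _ hx) (hb₁ _ hv)
  | pre e ih => exact fun σ' _ => ⟨fun v hv => by simpa using hv, by simpa [Term.scope] using
      (eval_lit.1 h)⟩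

/-- Induction on the derivation handles the recursion that structural induction cannot: the scope of
a function body is evaluated by a subderivation, and `ScopeFramed.framedBy` turns its induction
hypothesis into the frame property of the body. -/
theorem Eval.scopeFramed {α : Type} {e : Term W S α} {v : α} (h : Eval D σ₀ σ e v) :
    ScopeFramed D σ₀ σ e v := by
  induction h with
  | lit a => exact .lit a
  | op h hf ih => exact ⟨_, h, ih, hf⟩
  | pair _ _ ih₁ ih₂ => exact ⟨ih₁, ih₂⟩
  | deref h _ => exact .deref h
  | cond_true h _ _ ih => exact .inl ⟨h, ih⟩
  | cond_false h _ _ ih => exact .inr ⟨h, ih⟩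
  | and_true h h' _ _ => exact .and_true h h'
  | and_false_left h _ => exact .and_false_left h
  | and_false_right h _ => exact .and_false_right h
  | all_true h h' _ _ => exact .all_true h h'
  | all_false h hy h' _ _ => exact .all_false h hy h'
  | iUnion h _ _ ih => exact ⟨_, _, h, ih, rfl⟩
  | call h h' _ _ => exact .call h h'
  | @callScope _ f n _ _ _ h _ _ ih =>
    -- `scopeIter 0` is the scope of the body and `scopeIter (n + 1)` the scope of `scopeIter n`, so
    -- in both cases the premise evaluates a term of the form `e.scope`.
    match n, ih with
    | 0, ih => exact ⟨_, h, ih.framedBy⟩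
    | n + 1, ih => exact ⟨_, h, ih.framedBy⟩
  | pre h _ => exact .pre h

theorem Eval.scope_congr {α : Type} {e : Term W S α} {X : Set (MUnit W)}
    (h : Eval D σ₀ σ e.scope X) (hσ : ∀ u ∈ X, σ' u = σ u) : Eval D σ₀ σ' e.scope X :=
  (h.scopeFramed.framedBy σ' hσ).2

/-- The value of a term is determined by the memory in its scope. -/
theorem Eval.congr_of_scope {α : Type} {e : Term W S α} {X : Set (MUnit W)}
    (h : Eval D σ₀ σ e.scope X) (hσ : ∀ u ∈ X, σ' u = σ u) {v : α} :
    Eval D σ₀ σ e v ↔ Eval D σ₀ σ' e v :=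
  ⟨(h.scopeFramed.framedBy σ' hσ).1 v,
    -- The scope has the same value `X` in `σ'`, so the frame property also applies from `σ'` back
    -- to `σ`. Thus undefinedness is preserved as well.
    ((h.scope_congr hσ).scopeFramed.framedBy σ fun u hu => (hσ u hu).symm).1 v⟩

/-- The equivalence for terms is essential: `==` and `↓` are not monotone in definedness, so
persistence of defined values would not suffice. The scope at `σ'` is what re-establishes
`Outlying`. -/
theorem Formula.congr_of_scope {p : Formula W S} {X : Set (MUnit W)}
    (h : Eval D σ₀ σ p.scope X) (hσ : ∀ u ∈ X, σ' u = σ u) :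
    (∀ v, p.Is D σ₀ σ v ↔ p.Is D σ₀ σ' v) ∧ Eval D σ₀ σ' p.scope X := by
  induction p generalizing X with
  | tm e => exact ⟨fun v => h.congr_of_scope hσ, h.scope_congr hσ⟩
  | eq a b =>
    obtain ⟨A, B, ha, hb, rfl⟩ := eval_union.1 h
    have hA := fun u hu => hσ u (.inl hu)
    have hB := fun u hu => hσ u (.inr hu)
    exact ⟨fun v => by simp only [Formula.Is, ha.congr_of_scope hA, hb.congr_of_scope hB],
      eval_union.2 ⟨A, B, ha.scope_congr hA, hb.scope_congr hB, rfl⟩⟩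
  | seq a b =>
    obtain ⟨A, B, ha, hb, rfl⟩ := eval_union.1 h
    have hA := fun u hu => hσ u (.inl hu)
    have hB := fun u hu => hσ u (.inr hu)
    exact ⟨fun v => by simp only [Formula.Is, ha.congr_of_scope hA, hb.congr_of_scope hB],
      eval_union.2 ⟨A, B, ha.scope_congr hA, hb.scope_congr hB, rfl⟩⟩
  | dfn e =>
    exact ⟨fun v => by simp only [Formula.Is, Eval.congr_of_scope h hσ],
      Eval.scope_congr (e := e) h hσ⟩
  | and p q ihp ihq =>
    obtain ⟨A, B, ha, hb, rfl⟩ := eval_union.1 h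
    obtain ⟨hp, hp'⟩ := ihp ha fun u hu => hσ u (.inl hu)
    obtain ⟨hq, hq'⟩ := ihq hb fun u hu => hσ u (.inr hu)
    exact ⟨fun v => by cases v <;> simp only [Formula.Is, hp, hq],
      eval_union.2 ⟨A, B, hp', hq', rfl⟩⟩
  | not p ih => exact ⟨fun v => (ih h hσ).1 _, (ih h hσ).2⟩
  | all p ih =>
    obtain ⟨Y, F, hY, hF, rfl⟩ := eval_iUnion.1 h
    cases eval_lit.1 hY
    have hp := fun x => ih x (hF x trivial) fun u hu => hσ u (Set.mem_biUnion trivial hu)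
    exact ⟨fun v => by cases v <;> simp only [Formula.Is, (hp _).1],
      eval_iUnion.2 ⟨_, F, .lit _, fun x _ => (hp x).2, rfl⟩⟩

end Metatheory

/-! ### Relative completeness of the logic -/

section Completeness

variable {W : World} {S : FunSig} {D : FunDefs W S} {σ₀ σ σ' : Store W}

@[simp] theorem Formula.holds_and {p q : Formula W S} :
    (Formula.and p q).Holds D σ₀ σ ↔ p.Holds D σ₀ σ ∧ q.Holds D σ₀ σ := by
  simp [Holds, Is]

@[simp] theorem Formula.holds_or {p q : Formula W S} :
    (Formula.or p q).Holds D σ₀ σ ↔ p.Holds D σ₀ σ ∨ q.Holds D σ₀ σ := by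
  simp [Holds, Is, Formula.or]

@[simp] theorem Formula.holds_all {α : Type} {p : α → Formula W S} :
    (Formula.all p).Holds D σ₀ σ ↔ ∀ x, (p x).Holds D σ₀ σ := by
  simp [Holds, Is]

@[simp] theorem Formula.holds_ex {α : Type} {p : α → Formula W S} :
    (Formula.ex p).Holds D σ₀ σ ↔ ∃ x, (p x).Holds D σ₀ σ := by
  simp [Holds, Is, Formula.ex]

@[simp] theorem Formula.holds_tm {e : Term W S Bool} :
    (Formula.tm e).Holds D σ₀ σ ↔ Eval D σ₀ σ e true := Iff.rfl

@[simp] theorem Formula.holds_not_tm {e : Term W S Bool} :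
    (Formula.not (.tm e)).Holds D σ₀ σ ↔ Eval D σ₀ σ e false := Iff.rfl

@[simp] theorem Formula.holds_eq {α : Type} {a b : Term W S α} :
    (Formula.eq a b).Holds D σ₀ σ ↔ ∃ x, Eval D σ₀ σ a x ∧ Eval D σ₀ σ b x := by
  simp [Holds, Is]

theorem Formula.holds_bar {p : Formula W S} :
    p.bar.Holds D σ₀ σ ↔ p.Holds D σ σ := Formula.is_bar

theorem Formula.holds_disjointScope {ρ : Formula W S} {e : Term W S (Set (MUnit W))} :
    (ρ.disjointScope e).Holds D σ₀ σ ↔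
      ∃ X Y, Eval D σ₀ σ ρ.scope X ∧ Eval D σ₀ σ e Y ∧ X ∩ Y = ∅ := by
  simp [disjointScope, and_assoc]

theorem Formula.holds_outlying {ρ : Formula W S} {e : Term W S (Set (MUnit W))} :
    (ρ.outlying e).Holds D σ₀ σ ↔ ρ.Holds D σ₀ σ ∧
      ∃ X Y, Eval D σ₀ σ ρ.scope X ∧ Eval D σ₀ σ e Y ∧ X ∩ Y = ∅ := by
  rw [outlying, holds_and, holds_disjointScope]

theorem Expr.eval_toTerm {α : Type} {e : Expr W α} {v : α} :
    Eval D σ₀ σ (e.toTerm S) v ↔ e.eval σ = some v := by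
  induction e with
  | lit a => simp [Expr.toTerm, Expr.eval, eq_comm]
  | op f e ih => simp [Expr.toTerm, Expr.eval, ih, Option.bind_eq_some_iff]
  | pair a b iha ihb =>
    obtain ⟨x, y⟩ := v
    simp [Expr.toTerm, Expr.eval, iha, ihb, Option.bind_eq_some_iff]
  | deref e ih =>
    simp only [Expr.toTerm, Expr.eval, eval_deref, ih, Option.bind_eq_some_iff,
      Option.map_eq_some_iff]
    constructor
    · rintro ⟨c, h, rfl⟩
      exact ⟨_, h, c, rfl, rfl⟩
    · rintro ⟨_, h, c, rfl, rfl⟩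
      exact ⟨c, h, rfl⟩
  | cond c a b ihc iha ihb =>
    simp only [Expr.toTerm, Expr.eval, eval_cond, ihc, iha, ihb, Option.bind_eq_some_iff]
    simp [or_comm]

theorem Expr.toTerm_noPre {α : Type} (e : Expr W α) : (e.toTerm S).NoPre := by
  induction e <;> simp_all [Expr.toTerm, Term.NoPre]

/-- Every execution of `s` from `σ` is free of faults and ends in a state with the property `Q`. -/
def Stmt.Ensures (s : Stmt W) (σ : Store W) (Q : Store W → Prop) : Prop :=
  ∀ o : Option (Store W), Exec s σ o → ∃ σ' : Store W, o = some σ' ∧ Q σ'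

namespace Formula

/-- The formula stating that unit `u` has the content it has in `σ`. -/
def unitIs (S : FunSig) (σ : Store W) (u : MUnit W) : Formula W S :=
  .eq (.deref (τ := u.ty) (.lit (some ⟨u, rfl⟩))) (.lit (σ u))

/-- The formula stating that the current state is `σ`. -/
def stateIs (S : FunSig) (σ : Store W) : Formula W S := .all fun u => unitIs S σ u

/-- The formula stating that the current state has the property `P`. -/
def ofPred (S : FunSig) (P : Store W → Prop) : Formula W S :=
  .ex fun σ : {σ // P σ} => stateIs S σ.1

@[simp] theorem holds_unitIs {u : MUnit W} :
    (unitIs S σ' u).Holds D σ₀ σ ↔ σ u = σ' u := by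
  simp only [unitIs, holds_eq, eval_deref, eval_lit, Option.some.injEq, exists_eq_right]
  constructor
  · rintro ⟨_, rfl, h⟩
    exact h.symm
  · intro h
    exact ⟨_, rfl, h.symm⟩

@[simp] theorem holds_stateIs : (stateIs S σ').Holds D σ₀ σ ↔ σ = σ' := by
  simp [stateIs, funext_iff]

@[simp] theorem holds_ofPred {P : Store W → Prop} : (ofPred S P).Holds D σ₀ σ ↔ P σ := by
  simp [ofPred]

theorem ofPred_noPre (P : Store W → Prop) : (ofPred S P).NoPre := by
  simp [ofPred, stateIs, unitIs, NoPre, ex, Term.NoPre]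

end Formula

/-- A derivable specification of an assignment by the initial and the final state. -/
theorem Provable.assign_stateIs {τ : Ty W.OTy} {e₁ : Expr W (Val W (.ref τ))}
    {e₂ : Expr W (Val W τ)} {c : {u : MUnit W // u.ty = τ}} {v : Val W τ}
    (h₁ : e₁.eval σ = some (some c)) (h₂ : e₂.eval σ = some v) :
    Provable D (Formula.stateIs S σ) (.assign e₁ e₂) (Formula.stateIs S (σ.set c v)) := by
  obtain ⟨u, rfl⟩ := c
  -- `ρ` fixes all units except the assigned one and records the values of `e₁` and `e₂` by
  -- pre-state terms, whose scope is empty. So the scope of `ρ` is the complement of `{u}`.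
  let rest : Formula W S := .all fun w : {w // w ≠ u} => Formula.unitIs S σ w.1
  let ρ : Formula W S := .and rest (.and (.eq (.pre (e₁.toTerm S)) (.lit (some ⟨u, rfl⟩)))
    (.eq (.pre (e₂.toTerm S)) (.lit v)))
  -- `pre_2` turns the pre-state terms of the precondition into terms of the current state, whose
  -- values `stateIs` determines.
  refine (Provable.assign_st (D := D) ρ e₁ e₂).pre_2.conseq ?_ ?_
  · intro σ₀ σ₁ h
    obtain rfl := Formula.holds_stateIs.1 h
    rw [Formula.holds_bar, Formula.holds_and, Formula.holds_outlying]
    refine ⟨⟨?_, ?_⟩, ?_⟩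
    · simp [ρ, rest, Expr.eval_toTerm, h₁, h₂]
    · have hrest : Eval D σ₁ σ₁ rest.scope (⋃ w ∈ (Set.univ : Set {w // w ≠ u}), {w.1}) := by
        refine .iUnion (.lit _) fun w _ => eval_union.2 ⟨{w.1}, ∅, ?_, .lit _, by simp⟩
        exact eval_union.2 ⟨∅, {w.1}, .lit _, eval_unitSet.2 ⟨_, .lit _, rfl⟩, by simp⟩
      refine ⟨_, {u}, eval_union.2 ⟨_, ∅, hrest, ?_, rfl⟩,
        eval_unitSet.2 ⟨_, Expr.eval_toTerm.2 h₁, rfl⟩, by simp⟩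
      exact eval_union.2 ⟨∅, ∅, eval_union.2 ⟨∅, ∅, .lit _, .lit _, by simp⟩,
        eval_union.2 ⟨∅, ∅, .lit _, .lit _, by simp⟩, by simp⟩
    · rw [Formula.holds_and]
      refine ⟨⟨_, none, Expr.eval_toTerm.2 h₁, .lit _, by simp⟩, ?_⟩
      exact iff_of_true ⟨v, Expr.eval_toTerm.2 h₂⟩ rfl
  · intro σ₀ σ₁ h
    simp only [ρ, rest, Formula.holds_and, Formula.holds_all, Formula.holds_unitIs,
      Formula.holds_eq, eval_pre, eval_deref, eval_lit, exists_eq_right] at h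
    obtain ⟨⟨hrest, he₁, he₂⟩, x, ⟨c, hc, rfl⟩, hx⟩ := h
    cases hc.unique he₁
    rw [Formula.holds_stateIs]
    funext w
    by_cases hw : w = u
    · subst hw
      simpa [Store.set, Store.get] using hx.unique he₂
    · simpa [Store.set, hw] using hrest ⟨w, hw⟩

/-- Relative completeness, for properties of states. -/
theorem Provable.of_ensures (s : Stmt W) {P Q : Store W → Prop}
    (h : ∀ σ, P σ → s.Ensures σ Q) :
    Provable D (Formula.ofPred S P) s (Formula.ofPred S Q) := by
  induction s generalizing P Q with
  | skip =>
    refine (Provable.skip_st _).conseq (fun _ _ h => h) fun σ₀ σ hσ => ?_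
    obtain ⟨_, h, hQ⟩ := h σ (Formula.holds_ofPred.1 hσ) _ (.skip σ)
    cases h
    exact Formula.holds_ofPred.2 hQ
  | assign e₁ e₂ =>
    -- Each initial state gets its own derivation, from a single state to a single state; the rule
    -- `exist` then joins them.
    have key : ∀ σ : {σ // P σ}, ∃ σ', Q σ' ∧
        Provable D (Formula.stateIs S σ.1) (.assign e₁ e₂) (Formula.stateIs S σ') := by
      rintro ⟨σ, hσ⟩
      by_cases hf : e₁.eval σ = none ∨ e₁.eval σ = some none ∨ e₂.eval σ = none
      · obtain ⟨_, h, -⟩ := h σ hσ _ (.assign_fault hf)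
        cases h
      · obtain ⟨c, v, hc, hv⟩ : ∃ c v, e₁.eval σ = some (some c) ∧ e₂.eval σ = some v := by
          rcases h₁ : e₁.eval σ with _ | _ | c <;> rcases h₂ : e₂.eval σ with _ | v <;>
            simp_all
        obtain ⟨_, h, hQ⟩ := h σ hσ _ (.assign hc hv)
        cases h
        exact ⟨_, hQ, .assign_stateIs hc hv⟩
    choose f hf hp using key
    refine (Provable.exist hp).conseq (fun _ _ h => h) fun σ₀ σ hσ => ?_
    obtain ⟨x, hx⟩ := Formula.holds_ex.1 hσ
    cases Formula.holds_stateIs.1 hx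
    exact Formula.holds_ofPred.2 (hf x)
  | seq s₁ s₂ ih₁ ih₂ =>
    -- The intermediate assertion is the weakest precondition of `s₂`.
    refine .seq_st (q := Formula.ofPred S fun σ => s₂.Ensures σ Q) (Formula.ofPred_noPre _)
      (Formula.ofPred_noPre _) (Formula.ofPred_noPre _) (ih₁ fun σ hσ o ho => ?_)
      (ih₂ fun σ hσ => hσ)
    cases o with
    | none =>
      obtain ⟨_, h, -⟩ := h σ hσ _ (.seq_fault ho)
      cases h
    | some σ₁ => exact ⟨σ₁, rfl, fun o ho' => h σ hσ o (.seq ho ho')⟩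
  | ite e s₁ s₂ ih₁ ih₂ =>
    refine (Provable.if_st (p := Formula.ofPred S P) (q := Formula.ofPred S Q) (e := e)
      ((ih₁ (P := fun σ => P σ ∧ e.eval σ = some true) (Q := Q) ?_).conseq ?_ fun _ _ h => h)
      ((ih₂ (P := fun σ => P σ ∧ e.eval σ = some false) (Q := Q) ?_).conseq ?_
        fun _ _ h => h)).conseq ?_ fun _ _ h => h
    · exact fun σ hσ o ho => h σ hσ.1 o (.ite_true hσ.2 ho)
    · intro σ₀ σ hσ
      simpa [Expr.eval_toTerm] using hσ
    · exact fun σ hσ o ho => h σ hσ.1 o (.ite_false hσ.2 ho)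
    · intro σ₀ σ hσ
      simpa [Expr.eval_toTerm] using hσ
    · intro σ₀ σ hσ
      have hP := Formula.holds_ofPred.1 hσ
      simp only [Formula.holds_and, Formula.holds_or, Formula.holds_tm, Formula.holds_not_tm,
        Expr.eval_toTerm, Formula.holds_ofPred]
      refine ⟨hP, ?_⟩
      rcases he : e.eval σ with _ | _ | _
      · obtain ⟨_, h, -⟩ := h σ hP _ (.ite_fault he)
        cases h
      · exact .inr rfl
      · exact .inl rfl
  | _ =>
    rename_i e s ih
    -- The invariant is the weakest precondition of the loop itself. The body preserves it, since an
    -- execution of the loop after one iteration extends to one from before it.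
    let I : Store W → Prop := fun σ => (Stmt.while e s).Ensures σ Q
    have hdef : Entails D (Formula.ofPred S I) (.and (Formula.ofPred S I)
        (.or (.tm (e.toTerm S)) (.not (.tm (e.toTerm S))))) := by
      intro σ₀ σ hσ
      have hI := Formula.holds_ofPred.1 hσ
      simp only [Formula.holds_and, Formula.holds_or, Formula.holds_tm, Formula.holds_not_tm,
        Expr.eval_toTerm, Formula.holds_ofPred]
      refine ⟨hI, ?_⟩
      rcases he : e.eval σ with _ | _ | _
      · obtain ⟨_, h, -⟩ := hI _ (.while_fault he)
        cases h
      · exact .inr rfl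
      · exact .inl rfl
    have hbody : Provable D (.and (Formula.ofPred S I) (.tm (e.toTerm S))) s
        (Formula.ofPred S I) := by
      refine (ih (P := fun σ => I σ ∧ e.eval σ = some true) (Q := I) ?_).conseq ?_
        fun _ _ h => h
      · intro σ hσ o ho
        cases o with
        | none =>
          obtain ⟨_, h, -⟩ := hσ.1 _ (.while_body_fault hσ.2 ho)
          cases h
        | some σ₁ => exact ⟨σ₁, rfl, fun o ho' => hσ.1 o (.while_true hσ.2 ho ho')⟩
      · intro σ₀ σ hσ
        simpa [Expr.eval_toTerm] using hσ
    refine (Provable.while_st (Formula.ofPred_noPre I)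
      (hbody.conseq (fun _ _ h => h) hdef)).conseq (fun σ₀ σ hσ => hdef σ₀ σ ?_) ?_
    · exact Formula.holds_ofPred.2 (h σ (Formula.holds_ofPred.1 hσ))
    · intro σ₀ σ hσ
      simp only [Formula.holds_and, Formula.holds_not_tm, Expr.eval_toTerm,
        Formula.holds_ofPred] at hσ ⊢
      obtain ⟨_, h, hQ⟩ := hσ.2 _ (.while_false hσ.1)
      cases h
      exact hQ

theorem Formula.NoPre.holds_iff {p : Formula W S} (hn : p.NoPre) (σ₀ σ₁ : Store W) :
    p.Holds D σ₀ σ ↔ p.Holds D σ₁ σ := hn.is_iff σ₀ σ₁ true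

/-- Relative completeness: valid specifications without pre-state terms are derivable. -/
theorem Valid.provable {p q : Formula W S} {s : Stmt W} (h : Valid D p s q) (hp : p.NoPre)
    (hq : q.NoPre) : Provable D p s q := by
  -- Without pre-state terms, the truth of `p` and `q` is a property of the current state, so both
  -- are equivalent to formulas `ofPred`.
  refine (Provable.of_ensures s (P := fun σ => p.Holds D σ σ) (Q := fun σ => q.Holds D σ σ)
    fun σ hσ o ho => ?_).conseq (fun σ₀ σ hσ => ?_) (fun σ₀ σ hσ => ?_)
  · obtain ⟨σ', h, hq'⟩ := h σ hσ o ho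
    exact ⟨σ', h, (hq.holds_iff _ _).1 hq'⟩
  · exact Formula.holds_ofPred.2 ((hp.holds_iff _ _).1 hσ)
  · rw [Formula.holds_ofPred] at hσ
    exact (hq.holds_iff _ _).1 hσ

end Completeness

/-! ### Executions -/

section Executions

variable {W : World} {σ σ' : Store W} {Q : Store W → Prop}

theorem Stmt.Ensures.mono {s : Stmt W} {Q' : Store W → Prop} (h : s.Ensures σ Q)
    (hQ : ∀ σ', Q σ' → Q' σ') : s.Ensures σ Q' := fun o ho =>
  (h o ho).imp fun σ' h' => ⟨h'.1, hQ σ' h'.2⟩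

theorem Stmt.ensures_assign {τ : Ty W.OTy} {e₁ : Expr W (Val W (.ref τ))}
    {e₂ : Expr W (Val W τ)} {c : {u : MUnit W // u.ty = τ}} {v : Val W τ}
    (h₁ : e₁.eval σ = some (some c)) (h₂ : e₂.eval σ = some v) (hQ : Q (σ.set c v)) :
    (Stmt.assign e₁ e₂).Ensures σ Q := by
  intro o ho
  cases ho with
  | assign h₁' h₂' =>
    cases h₁.symm.trans h₁'
    cases h₂.symm.trans h₂'
    exact ⟨_, rfl, hQ⟩
  | assign_fault h => simp [h₁, h₂] at h

theorem Stmt.ensures_seq {s₁ s₂ : Stmt W} (h : s₁.Ensures σ fun σ' => s₂.Ensures σ' Q) :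
    (Stmt.seq s₁ s₂).Ensures σ Q := by
  intro o ho
  cases ho with
  | seq h₁ h₂ =>
    obtain ⟨_, h', hQ⟩ := h _ h₁
    cases h'
    exact hQ _ h₂
  | seq_fault h₁ =>
    obtain ⟨_, h', -⟩ := h _ h₁
    cases h'

theorem Stmt.ensures_ite {e : Expr W Bool} {s₁ s₂ : Stmt W} {b : Bool}
    (hb : e.eval σ = some b) (h : if b then s₁.Ensures σ Q else s₂.Ensures σ Q) :
    (Stmt.ite e s₁ s₂).Ensures σ Q := by
  intro o ho
  cases ho with
  | ite_true hb' ho =>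
    cases hb.symm.trans hb'
    exact h o ho
  | ite_false hb' ho =>
    cases hb.symm.trans hb'
    exact h o ho
  | ite_fault hb' => cases hb.symm.trans hb'

/-- Induction on a given finite execution; termination is not claimed, so no variant is needed.
`hdef` rules out a fault in the guard. -/
theorem Stmt.ensures_while {e : Expr W Bool} {s : Stmt W} {I : Store W → Prop}
    (hdef : ∀ σ, I σ → ∃ b, e.eval σ = some b)
    (hbody : ∀ σ, I σ → e.eval σ = some true → s.Ensures σ I) (hσ : I σ) :
    (Stmt.while e s).Ensures σ fun σ' => I σ' ∧ e.eval σ' = some false := by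
  intro o ho
  generalize hs : Stmt.while e s = st at ho
  induction ho with
  | while_true h h₁ h₂ _ ih =>
    cases hs
    obtain ⟨_, h', hI⟩ := hbody _ hσ h _ h₁
    cases h'
    exact ih hI rfl
  | while_body_fault h h₁ _ =>
    cases hs
    obtain ⟨_, h', -⟩ := hbody _ hσ h _ h₁
    cases h'
  | while_false h =>
    cases hs
    exact ⟨_, rfl, hσ, h⟩
  | while_fault h =>
    cases hs
    obtain ⟨b, hb⟩ := hdef _ hσ
    cases h.symm.trans hb
  | _ => cases hs

/-- The states `σ` and `σ'` agree on all units outside `M`. -/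
def AgreeOff (M : Set (MUnit W)) (σ σ' : Store W) : Prop := ∀ u ∉ M, σ' u = σ u

/-- No unit of the scope of `ρ` lies in `M`, so the stores agree on the scope, and both the truth of
`ρ` and its scope persist. -/
theorem Formula.Holds.outlying_congr {S : FunSig} {D : FunDefs W S} {σ₀ : Store W}
    {ρ : Formula W S} {M : Set (MUnit W)} (h : (ρ.outlying (.lit M)).Holds D σ₀ σ)
    (hσ : AgreeOff M σ σ') : (ρ.outlying (.lit M)).Holds D σ₀ σ' := by
  rw [Formula.holds_outlying] at h ⊢
  obtain ⟨hρ, X, Y, hX, hY, hXY⟩ := h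
  cases eval_lit.1 hY
  obtain ⟨h₁, h₂⟩ := Formula.congr_of_scope hX fun u hu =>
    hσ u fun hM => (hXY ▸ (⟨hu, hM⟩ : u ∈ X ∩ M) : u ∈ (∅ : Set (MUnit W)))
  exact ⟨(h₁ true).1 hρ, X, M, h₂, .lit _, hXY⟩

end Executions

namespace SW

/-! ### The Schorr-Waite program on states -/

section Memory

variable {W : World}

/-- The content of a program variable. -/
def getVar (σ : Store W) (v : Var) : NPtr W := σ (.var v)

/-- The content of a field of a node. -/
def getFld (σ : Store W) (n : Fld) (a : W.Node) : Val W n.ty := σ (.fld a n)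

/-- The state after an assignment to a program variable. -/
noncomputable def putVar (σ : Store W) (v : Var) (x : NPtr W) : Store W :=
  σ.set (τ := .node) ⟨.var v, rfl⟩ x

/-- The state after an assignment to a field of a node. -/
noncomputable def putFld (σ : Store W) (a : W.Node) (n : Fld) (x : Val W n.ty) : Store W :=
  σ.set ⟨.fld a n, rfl⟩ x

variable {σ σ' : Store W} {v w : Var} {m n : Fld} {a b : W.Node} {x : NPtr W}
  {y : Val W n.ty} {Q : Store W → Prop} {M : Set (MUnit W)}

open Classical in
@[simp] theorem getVar_putVar :
    getVar (putVar σ v x) w = if w = v then x else getVar σ w := by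
  by_cases h : w = v
  · subst h
    simp [getVar, putVar, Store.set]
  · simp [getVar, putVar, Store.set, h]

@[simp] theorem getVar_putFld : getVar (putFld σ a n y) w = getVar σ w := by
  simp [getVar, putFld, Store.set]

@[simp] theorem getFld_putVar : getFld (putVar σ v x) n a = getFld σ n a := by
  simp [getFld, putVar, Store.set]

open Classical in
@[simp] theorem getFld_putFld :
    getFld (putFld σ a n y) n b = if b = a then y else getFld σ n b := by
  by_cases h : b = a
  · subst h
    simp [getFld, putFld, Store.set]
  · simp [getFld, putFld, Store.set, h]

@[simp] theorem getFld_putFld_of_ne (h : m ≠ n) :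
    getFld (putFld σ a n y) m b = getFld σ m b := by
  simp [getFld, putFld, Store.set, h]

theorem agreeOff_refl : AgreeOff M σ σ := fun _ _ => rfl

theorem agreeOff_putVar (h : AgreeOff M σ σ') (hv : .var v ∈ M) :
    AgreeOff M σ (putVar σ' v x) := by
  intro u hu
  have hne : u ≠ .var v := by
    rintro rfl
    exact hu hv
  rw [← h u hu]
  simp [putVar, Store.set, hne]

theorem agreeOff_putFld (h : AgreeOff M σ σ') (hv : .fld a n ∈ M) :
    AgreeOff M σ (putFld σ' a n y) := by
  intro u hu
  have hne : u ≠ .fld a n := by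
    rintro rfl
    exact hu hv
  rw [← h u hu]
  simp [putFld, Store.set, hne]

@[simp] theorem eval_var : (var v).eval σ = some (getVar σ v) := rfl

theorem eval_fld {e : Expr W (NPtr W)} (he : e.eval σ = some (some a))
    (hy : getFld σ n a = y) : (fld e n).eval σ = some y := by
  subst hy
  simp only [fld, Expr.eval, he]
  rfl

@[simp] theorem eval_isNil {e : Expr W (NPtr W)} :
    (isNil e).eval σ = (e.eval σ).map Option.isNone := by
  simp [isNil, Expr.eval, Option.map_eq_bind]

@[simp] theorem eval_neg {e : Expr W Bool} : (neg e).eval σ = (e.eval σ).map (!·) := by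
  simp [neg, Expr.eval, Option.map_eq_bind]

theorem ensures_setVar {e : Expr W (NPtr W)} (he : e.eval σ = some x)
    (hQ : Q (putVar σ v x)) : (setVar v e).Ensures σ Q :=
  Stmt.ensures_assign rfl he hQ

theorem ensures_setFld {e : Expr W (Val W n.ty)} (hv : getVar σ v = some a)
    (he : e.eval σ = some y) (hQ : Q (putFld σ a n y)) : (setFld v n e).Ensures σ Q := by
  refine Stmt.ensures_assign (c := ⟨.fld a n, rfl⟩) ?_ he hQ
  simp [Expr.eval, hv, fldRef]

theorem ensures_initCode
    (hQ : Q (putVar (putVar σ .t (getVar σ .root)) .p none)) : initCode.Ensures σ Q :=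
  Stmt.ensures_seq <| ensures_setVar eval_var <| ensures_setVar rfl hQ

/-- Symbolic execution: all values written are expressed in the initial state `σ`, so the sequence
reads as one simultaneous update. -/
theorem ensures_popCode (ha : getVar σ .p = some a)
    (hQ : Q (putFld (putVar (putVar (putVar σ .q (getVar σ .t)) .t (some a)) .p
      (getFld σ .r a)) a .r (getVar σ .t))) : popCode.Ensures σ Q := by
  refine Stmt.ensures_seq (ensures_setVar eval_var ?_)
  refine Stmt.ensures_seq (ensures_setVar (x := some a) (by simp [ha]) ?_)
  refine Stmt.ensures_seq (ensures_setVar (x := getFld σ .r a)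
    (eval_fld (a := a) (by simp [ha]) (by simp)) ?_)
  exact ensures_setFld (a := a) (y := getVar σ .t) (by simp) (by simp) hQ

theorem ensures_tryRightCode (ha : getVar σ .p = some a)
    (hQ : Q (putFld (putFld (putFld (putVar (putVar σ .q (getVar σ .t)) .t (getFld σ .r a))
      a .r (getFld σ .l a)) a .l (getVar σ .t)) a .chk true)) : tryRightCode.Ensures σ Q := by
  refine Stmt.ensures_seq (ensures_setVar eval_var ?_)
  refine Stmt.ensures_seq (ensures_setVar (x := getFld σ .r a)
    (eval_fld (a := a) (by simp [ha]) (by simp)) ?_)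
  refine Stmt.ensures_seq (ensures_setFld (n := .r) (a := a) (y := getFld σ .l a) (by simp [ha])
    (eval_fld (n := .l) (a := a) (by simp [ha]) (by simp)) ?_)
  refine Stmt.ensures_seq (ensures_setFld (a := a) (y := getVar σ .t) (by simp [ha])
    (by simp) ?_)
  exact ensures_setFld (a := a) (by simp [ha]) rfl hQ

theorem ensures_pushCode (ha : getVar σ .t = some a)
    (hQ : Q (putFld (putFld (putFld (putVar (putVar (putVar σ .q (getVar σ .p)) .p (some a)) .t
      (getFld σ .l a)) a .l (getVar σ .p)) a .mk true) a .chk false)) :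
    pushCode.Ensures σ Q := by
  refine Stmt.ensures_seq (ensures_setVar eval_var ?_)
  refine Stmt.ensures_seq (ensures_setVar (x := some a) (by simp [ha]) ?_)
  refine Stmt.ensures_seq (ensures_setVar (x := getFld σ .l a)
    (eval_fld (a := a) (by simp [ha]) (by simp)) ?_)
  refine Stmt.ensures_seq (ensures_setFld (a := a) (y := getVar σ .p) (by simp) (by simp) ?_)
  refine Stmt.ensures_seq (ensures_setFld (a := a) (by simp) rfl ?_)
  exact ensures_setFld (a := a) (by simp) rfl hQ

end Memory

/-! ### The path invariant and its preservation by each branch. -/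

section Invariant

variable {W : World} {G : Graph W} {σ σ' : Store W}

/-- The value of `NextNode(x)`. -/
def nextVal (G : Graph W) (σ : Store W) : NPtr W → NPtr W
  | none => G.r₀
  | some a => if getFld σ .chk a = true then G.R₀ a else G.L₀ a

/-- The node is nil or marked. -/
def IsExplored (σ : Store W) : NPtr W → Prop
  | none => True
  | some a => getFld σ .mk a = true

/-- The value of the link `x→chk ? x→r : x→l`. -/
def linkVal (σ : Store W) (a : W.Node) : NPtr W :=
  if getFld σ .chk a = true then getFld σ .r a else getFld σ .l a

/-- The links from `x` lead through the nodes of the list to nil. -/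
def IsStack (σ : Store W) : NPtr W → List W.Node → Prop
  | x, [] => x = none
  | x, a :: s => x = some a ∧ IsStack σ (linkVal σ a) s

/-- The list is the stack of `x`, and its nodes have the properties demanded by `InPath`. -/
def IsInPath (G : Graph W) (σ : Store W) : NPtr W → List W.Node → Prop
  | x, [] => x = none
  | x, a :: s => x = some a ∧ some a ∈ G.NS₀ ∧ getFld σ .mk a = true ∧
      nextVal G σ (linkVal σ a) = some a ∧
      (if getFld σ .chk a = true then getFld σ .l a = G.L₀ a ∧ IsExplored σ (G.L₀ a)
        else getFld σ .r a = G.R₀ a) ∧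
      IsInPath G σ (linkVal σ a) s

/-- The properties demanded by `OutPath` of a node. -/
def IsOutPath (G : Graph W) (σ : Store W) (a : W.Node) : Prop :=
  getFld σ .l a = G.L₀ a ∧ getFld σ .r a = G.R₀ a ∧
    (getFld σ .mk a = true →
      getFld σ .chk a = true ∧ IsExplored σ (G.L₀ a) ∧ IsExplored σ (G.R₀ a))

/-- The invariant as a property of states. -/
structure IsInv (G : Graph W) (σ : Store W) (s : List W.Node) : Prop where
  inPath : IsInPath G σ (getVar σ .p) s
  nodup : s.Nodup
  nil_notMem : none ∉ G.NS₀
  outPath : ∀ a, some a ∈ G.NS₀ → a ∉ s → IsOutPath G σ a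
  next : nextVal G σ (getVar σ .p) = getVar σ .t

theorem IsInPath.isStack {x : NPtr W} {s : List W.Node} (h : IsInPath G σ x s) :
    IsStack σ x s := by
  induction s generalizing x with
  | nil => exact h
  | cons a s ih => exact ⟨h.1, ih h.2.2.2.2.2⟩

theorem IsInPath.marked {x : NPtr W} {s : List W.Node} (h : IsInPath G σ x s) {a : W.Node}
    (ha : a ∈ s) : getFld σ .mk a = true := by
  induction s generalizing x with
  | nil => cases ha
  | cons b s ih =>
    obtain rfl | ha := List.mem_cons.1 ha
    · exact h.2.2.1
    · exact ih h.2.2.2.2.2 ha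

theorem IsExplored.mono (hmk : ∀ a, getFld σ .mk a = true → getFld σ' .mk a = true)
    {x : NPtr W} (h : IsExplored σ x) : IsExplored σ' x := by
  cases x with
  | none => trivial
  | some a => exact hmk a h

theorem IsInPath.nextVal_congr {x : NPtr W} {s : List W.Node} (h : IsInPath G σ x s)
    (hchk : ∀ a ∈ s, getFld σ' .chk a = getFld σ .chk a) : nextVal G σ' x = nextVal G σ x := by
  cases s with
  | nil =>
    cases h
    rfl
  | cons a s =>
    cases h.1
    simp [nextVal, hchk a (by simp)]

/-- Of `chk`, `l` and `r` only the values on the list matter, and marks occur only positively. So a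
branch may alter nodes off the list and add marks anywhere. -/
theorem IsInPath.congr {x : NPtr W} {s : List W.Node} (h : IsInPath G σ x s)
    (hchk : ∀ a ∈ s, getFld σ' .chk a = getFld σ .chk a)
    (hl : ∀ a ∈ s, getFld σ' .l a = getFld σ .l a)
    (hr : ∀ a ∈ s, getFld σ' .r a = getFld σ .r a)
    (hmk : ∀ a, getFld σ .mk a = true → getFld σ' .mk a = true) : IsInPath G σ' x s := by
  induction s generalizing x with
  | nil => exact h
  | cons a s ih =>
    simp only [List.forall_mem_cons] at hchk hl hr
    obtain ⟨hx, hns, hm, hn, hc, hs⟩ := h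
    have hlink : linkVal σ' a = linkVal σ a := by simp [linkVal, hchk.1, hl.1, hr.1]
    refine ⟨hx, hns, hmk a hm, ?_, ?_, ?_⟩
    · rw [hlink, hs.nextVal_congr hchk.2, hn]
    · rw [hchk.1, hl.1, hr.1]
      split_ifs at hc ⊢
      · exact ⟨hc.1, hc.2.mono hmk⟩
      · exact hc
    · rw [hlink]
      exact ih hs hchk.2 hl.2 hr.2

theorem var_p_mem_mset : MUnit.var .p ∈ MSet G := by simp [MSet]

theorem var_t_mem_mset : MUnit.var .t ∈ MSet G := by simp [MSet]

theorem var_q_mem_mset : MUnit.var .q ∈ MSet G := by simp [MSet]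

theorem fld_mem_mset {a : W.Node} (ha : some a ∈ G.NS₀) (n : Fld) : MUnit.fld a n ∈ MSet G :=
  .inr (Set.mem_biUnion ha ⟨n, rfl⟩)

open Classical in
-- As `chk` is set, `NextNode(p) = t` says that the missing edge `R₀ a` is `t`, which is explored;
-- the left edge is intact and explored by `InPath`. Writing `t` into `r` therefore restores `a`,
-- which may leave the path. The new equation for `NextNode` was stored in the `InPath` condition of
-- `a`.
theorem IsInv.pop {a : W.Node} {s : List W.Node} (h : IsInv G σ (a :: s))
    (hchk : getFld σ .chk a = true) (ht : IsExplored σ (getVar σ .t))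
    (hp' : getVar σ' .p = getFld σ .r a) (ht' : getVar σ' .t = some a)
    (hl' : ∀ b, getFld σ' .l b = getFld σ .l b)
    (hr' : ∀ b, getFld σ' .r b = if b = a then getVar σ .t else getFld σ .r b)
    (hmk' : ∀ b, getFld σ' .mk b = getFld σ .mk b)
    (hchk' : ∀ b, getFld σ' .chk b = getFld σ .chk b) : IsInv G σ' s := by
  obtain ⟨⟨hp, -, hm, hn, hc, hs⟩, hnd, hnil, hout, hnext⟩ := h
  have hlink : linkVal σ a = getFld σ .r a := if_pos hchk
  obtain ⟨has, hnd⟩ := List.nodup_cons.1 hnd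
  rw [hlink] at hn hs
  rw [if_pos hchk] at hc
  have hR : G.R₀ a = getVar σ .t := by rw [← hnext, hp]; exact (if_pos hchk).symm
  have hmono : ∀ b, getFld σ .mk b = true → getFld σ' .mk b = true := fun b h => by rwa [hmk']
  refine ⟨?_, hnd, hnil, fun b hb hbs => ?_, ?_⟩
  · rw [hp']
    refine hs.congr (fun b _ => hchk' b) (fun b _ => hl' b) (fun b hb => ?_) hmono
    -- Acyclicity enters here: `a` does not recur further down the path, so restoring its `r` breaks
    -- no link.
    rw [hr', if_neg (by rintro rfl; exact has hb)]
  · rw [IsOutPath, hl', hr', hmk', hchk']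
    by_cases hba : b = a
    · subst hba
      rw [if_pos rfl, hR]
      exact ⟨hc.1, rfl, fun _ => ⟨hchk, hc.2.mono hmono, ht.mono hmono⟩⟩
    · rw [if_neg hba]
      obtain ⟨h₁, h₂, h₃⟩ := hout b hb (by simp [hba, hbs])
      exact ⟨h₁, h₂, fun h => ⟨(h₃ h).1, (h₃ h).2.1.mono hmono, (h₃ h).2.2.mono hmono⟩⟩
  · rw [hp', ht', hs.nextVal_congr fun b _ => hchk' b, hn]

open Classical in
-- Three pointers rotate: the link moves from `l` to `r`, the missing edge `L₀ a = t` returns to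
-- `l`, and the edge `R₀ a`, intact until then, moves to `t`. Setting `chk` makes the link and the
-- missing edge be read on the new sides, so the list is unchanged.
theorem IsInv.tryRight {a : W.Node} {s : List W.Node} (h : IsInv G σ (a :: s))
    (hchk : getFld σ .chk a = false) (ht : IsExplored σ (getVar σ .t))
    (hp' : getVar σ' .p = getVar σ .p) (ht' : getVar σ' .t = getFld σ .r a)
    (hl' : ∀ b, getFld σ' .l b = if b = a then getVar σ .t else getFld σ .l b)
    (hr' : ∀ b, getFld σ' .r b = if b = a then getFld σ .l a else getFld σ .r b)
    (hmk' : ∀ b, getFld σ' .mk b = getFld σ .mk b)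
    (hchk' : ∀ b, getFld σ' .chk b = if b = a then true else getFld σ .chk b) :
    IsInv G σ' (a :: s) := by
  obtain ⟨⟨hp, hns, hm, hn, hc, hs⟩, hnd, hnil, hout, hnext⟩ := h
  have hlink : linkVal σ a = getFld σ .l a := by simp [linkVal, hchk]
  have has : a ∉ s := (List.nodup_cons.1 hnd).1
  rw [hlink] at hn hs
  rw [if_neg (by simp [hchk])] at hc
  have hL : G.L₀ a = getVar σ .t := by rw [← hnext, hp]; simp [nextVal, hchk]
  have hmono : ∀ b, getFld σ .mk b = true → getFld σ' .mk b = true := fun b h => by rwa [hmk']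
  have hchka : getFld σ' .chk a = true := by rw [hchk', if_pos rfl]
  have hlink' : linkVal σ' a = getFld σ .l a := by rw [linkVal, if_pos hchka, hr', if_pos rfl]
  have hne : ∀ b ∈ s, b ≠ a := by
    rintro b hb rfl
    exact has hb
  have hchks : ∀ b ∈ s, getFld σ' .chk b = getFld σ .chk b := fun b hb => by
    rw [hchk', if_neg (hne b hb)]
  refine ⟨⟨hp' ▸ hp, hns, hmono a hm, ?_, ?_, ?_⟩, hnd, hnil, fun b hb hbs => ?_, ?_⟩
  · rw [hlink', hs.nextVal_congr hchks, hn]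
  · rw [if_pos hchka, hl', if_pos rfl, hL]
    exact ⟨rfl, ht.mono hmono⟩
  · rw [hlink']
    refine hs.congr hchks (fun b hb => ?_) (fun b hb => ?_) hmono
    · rw [hl', if_neg (hne b hb)]
    · rw [hr', if_neg (hne b hb)]
  · have hba : b ≠ a := fun h => hbs (by simp [h])
    rw [IsOutPath, hl', hr', hmk', hchk', if_neg hba, if_neg hba, if_neg hba]
    obtain ⟨h₁, h₂, h₃⟩ := hout b hb hbs
    exact ⟨h₁, h₂, fun h => ⟨(h₃ h).1, (h₃ h).2.1.mono hmono, (h₃ h).2.2.mono hmono⟩⟩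
  · rw [hp', hp, ht', hc]
    exact if_pos hchka

open Classical in
-- Off the path the fields of `b` are original, so overwriting `l` loses only `L₀ b`, which is kept
-- in `t`. The old equation `NextNode(p) = b` becomes the `InPath` condition of the new top node.
theorem IsInv.push {b : W.Node} {s : List W.Node} (h : IsInv G σ s)
    (hbs : b ∉ s) (hb : some b ∈ G.NS₀) (ht : getVar σ .t = some b)
    (hp' : getVar σ' .p = some b) (ht' : getVar σ' .t = getFld σ .l b)
    (hl' : ∀ c, getFld σ' .l c = if c = b then getVar σ .p else getFld σ .l c)
    (hr' : ∀ c, getFld σ' .r c = getFld σ .r c)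
    (hmk' : ∀ c, getFld σ' .mk c = if c = b then true else getFld σ .mk c)
    (hchk' : ∀ c, getFld σ' .chk c = if c = b then false else getFld σ .chk c) :
    IsInv G σ' (b :: s) := by
  obtain ⟨hs, hnd, hnil, hout, hnext⟩ := h
  have hmono : ∀ c, getFld σ .mk c = true → getFld σ' .mk c = true := fun c h => by
    rw [hmk', h, ite_self]
  have hchkb : getFld σ' .chk b = false := by rw [hchk', if_pos rfl]
  have hlink' : linkVal σ' b = getVar σ .p := by
    rw [linkVal, if_neg (by simp [hchkb]), hl', if_pos rfl]
  have hne : ∀ c ∈ s, c ≠ b := by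
    rintro c hc rfl
    exact hbs hc
  have hchks : ∀ c ∈ s, getFld σ' .chk c = getFld σ .chk c := fun c hc => by
    rw [hchk', if_neg (hne c hc)]
  obtain ⟨hbl, hbr, -⟩ := hout b hb hbs
  refine ⟨⟨hp', hb, ?_, ?_, ?_, ?_⟩, List.nodup_cons.2 ⟨hbs, hnd⟩, hnil,
    fun c hc hcs => ?_, ?_⟩
  · rw [hmk', if_pos rfl]
  · rw [hlink', hs.nextVal_congr hchks, hnext, ht]
  · rw [if_neg (by simp [hchkb]), hr', hbr]
  · rw [hlink']
    refine hs.congr hchks (fun c hc => ?_) (fun c _ => hr' c) hmono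
    rw [hl', if_neg (hne c hc)]
  · simp only [List.mem_cons, not_or] at hcs
    rw [IsOutPath, hl', hr', hmk', hchk', if_neg hcs.1, if_neg hcs.1, if_neg hcs.1]
    obtain ⟨h₁, h₂, h₃⟩ := hout c hc hcs.2
    exact ⟨h₁, h₂, fun h => ⟨(h₃ h).1, (h₃ h).2.1.mono hmono, (h₃ h).2.2.mono hmono⟩⟩
  · rw [hp', ht', hbl]
    simp [nextVal, hchkb]

/-- The next node is nil or belongs to the graph. -/
theorem IsInv.next_mem {s : List W.Node} (h : IsInv G σ s) {b : W.Node}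
    (ht : getVar σ .t = some b) : some b ∈ G.NS₀ := by
  obtain ⟨hs, -, -, -, hnext⟩ := h
  rw [ht] at hnext
  rw [← hnext]
  cases s with
  | nil =>
    rw [show getVar σ .p = none from hs]
    exact .start
  | cons a s =>
    rw [hs.1] at hnext ⊢
    simp only [nextVal] at hnext ⊢
    split_ifs at hnext ⊢
    -- `NS₀` is closed only under non-nil edges; this one is non-nil because its target is `some b`.
    · exact .right hs.2.1 (by simp [hnext])
    · exact .left hs.2.1 (by simp [hnext])

/-! ### The guards, one iteration of the loop, and its exit. -/

theorem eval_fld_mk {v : Var} {b : W.Node} (h : getVar σ v = some b) :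
    Expr.eval σ (α := Bool) (fld (var v) .mk) = some (getFld σ .mk b) :=
  eval_fld (n := .mk) (by simp [h]) rfl

theorem eval_cond1 (σ : Store W) :
    ∃ c, cond1.eval σ = some c ∧ (c = true ↔ IsExplored σ (getVar σ .t)) := by
  rcases ht : getVar σ .t with _ | b
  · simp [cond1, Expr.eval, ht, IsExplored]
  · simp [cond1, Expr.eval, ht, IsExplored, eval_fld_mk ht]

/-- The guard is defined in every state, because the conditionals read `t→mk` only when `t` is not
nil. -/
theorem eval_condWh (σ : Store W) : ∃ c, condWh.eval σ = some c ∧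
    (c = false ↔ getVar σ .p = none ∧ IsExplored σ (getVar σ .t)) := by
  rcases hp : getVar σ .p with _ | a
  · rcases ht : getVar σ .t with _ | b
    · simp [condWh, Expr.eval, hp, ht, IsExplored]
    · simp [condWh, Expr.eval, hp, ht, IsExplored, eval_fld_mk ht]
  · simp [condWh, Expr.eval, hp]

theorem ensures_loopBody {s : List W.Node} (h : IsInv G σ s)
    (hc : condWh.eval σ = some true) :
    loopBody.Ensures σ fun σ' => (∃ s, IsInv G σ' s) ∧ AgreeOff (MSet G) σ σ' := by
  obtain ⟨c, hc', hcond⟩ := eval_condWh σ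
  cases hc.symm.trans hc'
  obtain ⟨c₁, hc₁, hcond₁⟩ := eval_cond1 σ
  refine Stmt.ensures_ite hc₁ ?_
  split_ifs with hct
  · have ht := hcond₁.1 hct
    cases s with
    -- An empty path with `t` explored is the exit condition, so `p` can be dereferenced in this
    -- branch.
    | nil => exact absurd (hcond.2 ⟨h.inPath, ht⟩) (by simp)
    | cons a s =>
      have hp := h.inPath.1
      have ha := h.inPath.2.1
      refine Stmt.ensures_ite (b := getFld σ .chk a) (eval_fld (n := .chk) (by simp [hp]) rfl) ?_
      split_ifs with hchk
      · refine ensures_popCode hp ⟨⟨s, h.pop hchk ht ?_ ?_ ?_ ?_ ?_ ?_⟩, ?_⟩ <;> try simp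
        exact agreeOff_putFld (agreeOff_putVar (agreeOff_putVar (agreeOff_putVar agreeOff_refl
          var_q_mem_mset) var_t_mem_mset) var_p_mem_mset) (fld_mem_mset ha _)
      · refine ensures_tryRightCode hp ⟨⟨a :: s, h.tryRight (by simpa using hchk) ht
          ?_ ?_ ?_ ?_ ?_ ?_⟩, ?_⟩ <;> try simp
        exact agreeOff_putFld (agreeOff_putFld (agreeOff_putFld (agreeOff_putVar
          (agreeOff_putVar agreeOff_refl var_q_mem_mset) var_t_mem_mset)
          (fld_mem_mset ha _)) (fld_mem_mset ha _)) (fld_mem_mset ha _)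
  · have ht := fun ht => hct (hcond₁.2 ht)
    rcases hb : getVar σ .t with _ | b
    · rw [hb] at ht
      exact (ht trivial).elim
    · have hmem := h.next_mem hb
      -- Nodes on the path are marked and `b` is not, so pushing `b` creates no cycle.
      have hbs : b ∉ s := fun hbs => ht (by rw [hb]; exact h.inPath.marked hbs)
      refine ensures_pushCode hb ⟨⟨b :: s, h.push hbs hmem hb ?_ ?_ ?_ ?_ ?_ ?_⟩, ?_⟩ <;>
        try simp
      exact agreeOff_putFld (agreeOff_putFld (agreeOff_putFld (agreeOff_putVar
        (agreeOff_putVar (agreeOff_putVar agreeOff_refl var_q_mem_mset) var_p_mem_mset)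
        var_t_mem_mset) (fld_mem_mset hmem _)) (fld_mem_mset hmem _)) (fld_mem_mset hmem _)

theorem isInv_initCode (hnil : none ∉ G.NS₀) (hroot : getVar σ .root = G.r₀)
    (h : ∀ a, some a ∈ G.NS₀ →
      getFld σ .mk a = false ∧ getFld σ .l a = G.L₀ a ∧ getFld σ .r a = G.R₀ a) :
    IsInv G (putVar (putVar σ .t (getVar σ .root)) .p none) [] := by
  refine ⟨by simp [IsInPath], List.nodup_nil, hnil, fun a ha _ => ?_, by simp [nextVal, hroot]⟩
  obtain ⟨hm, hl, hr⟩ := h a ha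
  simp [IsOutPath, hm, hl, hr]

/-- With `p` nil, `OutPath` covers all of `NS₀` and `t` is `r₀`. So `r₀` is explored, exploredness
passes along edges, and induction on reachability applies. -/
theorem IsInv.marked_of_exit {s : List W.Node} (h : IsInv G σ s) (hp : getVar σ .p = none)
    (ht : IsExplored σ (getVar σ .t)) {a : W.Node} (ha : some a ∈ G.NS₀) :
    getFld σ .mk a = true ∧ getFld σ .chk a = true ∧ getFld σ .l a = G.L₀ a ∧
      getFld σ .r a = G.R₀ a := by
  obtain ⟨hs, -, hnil, hout, hnext⟩ := h
  cases s with
  | cons b s => cases hp.symm.trans hs.1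
  | nil =>
    have key : ∀ x, G.Reach x → IsExplored σ x := by
      intro x hx
      induction hx with
      | start =>
        rw [← hnext, hp] at ht
        exact ht
      | left hx _ ih => exact ((hout _ hx (by simp)).2.2 ih).2.1
      | right hx _ ih => exact ((hout _ hx (by simp)).2.2 ih).2.2
    have hm : getFld σ .mk a = true := key _ ha
    obtain ⟨hl, hr, h⟩ := hout a ha (by simp)
    exact ⟨hm, (h hm).1, hl, hr⟩

end Invariant

/-! ### The specification of the Schorr-Waite program -/

section Specification

variable {W : World} {G : Graph W} {U : FunSig} {ub : (f : U.Sym) → U.Dom f → Tm W U (U.Cod f)}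
  {hub : ∀ f x, (ub f x).NoPre} {σ₀ σ : Store W}

/-! ### Truth conditions of the terms and recursive functions of the specification. -/

theorem eval_tvar {v : Var} {y : NPtr W} :
    Eval (defs G ub hub) σ₀ σ (tvar v) y ↔ y = getVar σ v := by
  refine eval_deref.trans ⟨?_, fun h => ⟨_, .lit _, h⟩⟩
  rintro ⟨c, hc, rfl⟩
  cases eval_lit.1 hc
  rfl

theorem eval_tfld {e : Tm W U (NPtr W)} {n : Fld} {y : Val W n.ty} :
    Eval (defs G ub hub) σ₀ σ (tfld e n) y ↔
      ∃ a, Eval (defs G ub hub) σ₀ σ e (some a) ∧ y = getFld σ n a := by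
  simp only [tfld, eval_deref, eval_op, fldRef]
  constructor
  · rintro ⟨c, ⟨_ | a, h, h'⟩, rfl⟩
    · cases h'
    · cases h'
      exact ⟨a, h, rfl⟩
  · rintro ⟨a, h, rfl⟩
    exact ⟨⟨.fld a n, rfl⟩, ⟨some a, h, rfl⟩, rfl⟩

theorem eval_tfld_mk {e : Tm W U (NPtr W)} {y : Bool} :
    Eval (defs G ub hub) σ₀ σ (α := Bool) (tfld e .mk) y ↔
      ∃ a, Eval (defs G ub hub) σ₀ σ e (some a) ∧ getFld σ .mk a = y := by
  simp only [eq_comm (b := y)]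
  exact eval_tfld

theorem eval_tfld_chk {e : Tm W U (NPtr W)} {y : Bool} :
    Eval (defs G ub hub) σ₀ σ (α := Bool) (tfld e .chk) y ↔
      ∃ a, Eval (defs G ub hub) σ₀ σ e (some a) ∧ getFld σ .chk a = y := by
  simp only [eq_comm (b := y)]
  exact eval_tfld

theorem eval_tfld_l {e : Tm W U (NPtr W)} {y : NPtr W} :
    Eval (defs G ub hub) σ₀ σ (α := NPtr W) (tfld e .l) y ↔
      ∃ a, Eval (defs G ub hub) σ₀ σ e (some a) ∧ y = getFld σ .l a := eval_tfld

theorem eval_tfld_r {e : Tm W U (NPtr W)} {y : NPtr W} :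
    Eval (defs G ub hub) σ₀ σ (α := NPtr W) (tfld e .r) y ↔
      ∃ a, Eval (defs G ub hub) σ₀ σ e (some a) ∧ y = getFld σ .r a := eval_tfld

theorem eval_tnil {e : Tm W U (NPtr W)} {y : Bool} :
    Eval (defs G ub hub) σ₀ σ (tnil e) y ↔
      ∃ x, Eval (defs G ub hub) σ₀ σ e x ∧ x.isNone = y := by
  simp [tnil]

theorem eval_tL {e : Tm W U (NPtr W)} {y : NPtr W} :
    Eval (defs G ub hub) σ₀ σ (tL G e) y ↔
      ∃ a, Eval (defs G ub hub) σ₀ σ e (some a) ∧ y = G.L₀ a := by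
  simp only [tL, eval_op, Option.map_eq_some_iff]
  constructor
  · rintro ⟨_, h, a, rfl, rfl⟩
    exact ⟨a, h, rfl⟩
  · rintro ⟨a, h, rfl⟩
    exact ⟨_, h, a, rfl, rfl⟩

theorem eval_tR {e : Tm W U (NPtr W)} {y : NPtr W} :
    Eval (defs G ub hub) σ₀ σ (tR G e) y ↔
      ∃ a, Eval (defs G ub hub) σ₀ σ e (some a) ∧ y = G.R₀ a := by
  simp only [tR, eval_op, Option.map_eq_some_iff]
  constructor
  · rintro ⟨_, h, a, rfl, rfl⟩
    exact ⟨a, h, rfl⟩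
  · rintro ⟨a, h, rfl⟩
    exact ⟨_, h, a, rfl, rfl⟩

theorem eval_nextNode {e : Tm W U (NPtr W)} {y : NPtr W} :
    Eval (defs G ub hub) σ₀ σ (nextNode e) y ↔
      ∃ x, Eval (defs G ub hub) σ₀ σ e x ∧ y = nextVal G σ x := by
  refine eval_call.trans (exists_congr fun x => and_congr_right fun _ => ?_)
  change Eval (defs G ub hub) σ₀ σ (nextNodeBody G x) y ↔ _
  cases x with
  | none => simp [nextNodeBody, eval_tnil, nextVal]
  | some a =>
    cases h : getFld σ .chk a <;>
      simp [nextNodeBody, eval_tnil, eval_tfld_chk, eval_tL, eval_tR, nextVal, h]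

theorem eval_explored {e : Tm W U (NPtr W)} :
    Eval (defs G ub hub) σ₀ σ (explored e) true ↔
      ∃ x, Eval (defs G ub hub) σ₀ σ e x ∧ IsExplored σ x := by
  refine eval_call.trans (exists_congr fun x => and_congr_right fun _ => ?_)
  change Eval (defs G ub hub) σ₀ σ (exploredBody x) true ↔ _
  cases x with
  | none => simp [exploredBody, eval_tnil, IsExplored]
  | some a => simp [exploredBody, eval_tnil, eval_tfld_mk, IsExplored]

theorem eval_link {a : W.Node} {y : NPtr W} :
    Eval (defs G ub hub) σ₀ σ (link (some a)) y ↔ y = linkVal σ a := by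
  cases h : getFld σ .chk a <;>
    simp [link, eval_tfld_chk, eval_tfld_l, eval_tfld_r, linkVal, h]

/-- As a least fixed point, `Stack` is defined only when the links reach nil after finitely many
steps. The induction is on the value `y`, since each unfolding (`hbody`) consumes one element. -/
theorem eval_stackBody {x : NPtr W} {y : List (NPtr W)} :
    Eval (defs G ub hub) σ₀ σ (stackBody x) y ↔ ∃ s, IsStack σ x s ∧ y = s.map some := by
  have hcall : ∀ a z, Eval (defs G ub hub) σ₀ σ (stack (link (some a))) z ↔
      Eval (defs G ub hub) σ₀ σ (stackBody (linkVal σ a)) z := by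
    intro a z
    refine eval_call.trans ⟨?_, fun h => ⟨_, eval_link.2 rfl, h⟩⟩
    rintro ⟨x, hx, h⟩
    cases eval_link.1 hx
    exact h
  have hbody : ∀ x y, Eval (defs G ub hub) σ₀ σ (stackBody x) y ↔
      (x = none ∧ y = []) ∨ ∃ a z, x = some a ∧
        Eval (defs G ub hub) σ₀ σ (stackBody (linkVal σ a)) z ∧ y = some a :: z := by
    rintro (_ | a) y
    · simp [stackBody, eval_tnil]
    · simp [stackBody, eval_tnil, hcall, ← eq_comm (a := y)]
  rw [hbody]
  induction y generalizing x with
  | nil =>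
    simp only [and_true, reduceCtorEq, and_false, exists_false, or_false]
    constructor
    · rintro rfl
      exact ⟨[], rfl, rfl⟩
    · rintro ⟨_ | _, h, h'⟩
      · exact h
      · cases h'
  | cons b y ih =>
    constructor
    · rintro (⟨-, h⟩ | ⟨a, z, rfl, hz, h⟩)
      · cases h
      · cases h
        obtain ⟨s, hs, rfl⟩ := ih.1 ((hbody _ _).1 hz)
        exact ⟨a :: s, ⟨rfl, hs⟩, rfl⟩
    · rintro ⟨_ | ⟨a, s⟩, h, h'⟩
      · cases h'
      · cases h'
        exact .inr ⟨a, _, h.1, (hbody _ _).2 (ih.2 ⟨s, h.2, rfl⟩), rfl⟩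

theorem eval_stack {v : Var} {y : List (NPtr W)} :
    Eval (defs G ub hub) σ₀ σ (stack (tvar v)) y ↔
      ∃ s, IsStack σ (getVar σ v) s ∧ y = s.map some := by
  refine eval_call.trans ⟨?_, fun h => ⟨_, eval_tvar.2 rfl, eval_stackBody.2 h⟩⟩
  rintro ⟨x, hx, h⟩
  cases eval_tvar.1 hx
  exact eval_stackBody.1 h

theorem eval_isAcyclicBody {s : List (NPtr W)} :
    Eval (defs G ub hub) σ₀ σ (isAcyclicBody s) true ↔ s.Nodup := by
  induction s with
  | nil => simp [isAcyclicBody]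
  | cons a s ih =>
    have hcall : Eval (defs G ub hub) σ₀ σ (acyclic (.lit s)) true ↔
        Eval (defs G ub hub) σ₀ σ (isAcyclicBody s) true := by
      refine eval_call.trans ⟨?_, fun h => ⟨_, .lit _, h⟩⟩
      rintro ⟨x, hx, h⟩
      cases eval_lit.1 hx
      exact h
    rw [isAcyclicBody, eval_and_true, hcall, ih]
    simp

theorem eval_acyclic {e : Tm W U (List (NPtr W))} :
    Eval (defs G ub hub) σ₀ σ (acyclic e) true ↔
      ∃ s, Eval (defs G ub hub) σ₀ σ e s ∧ s.Nodup :=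
  eval_call.trans (exists_congr fun _ => and_congr_right fun _ => eval_isAcyclicBody)

/-- `InPath` recurses along the same links as `Stack`, so the finite stack list carries the
induction. -/
theorem eval_inPathBody {x : NPtr W} {s : List W.Node} (hs : IsStack σ x s) :
    Eval (defs G ub hub) σ₀ σ (inPathBody G x) true ↔ IsInPath G σ x s := by
  induction s generalizing x with
  | nil =>
    cases hs
    simp [inPathBody, eval_tnil, IsInPath]
  | cons a s ih =>
    obtain ⟨rfl, hs⟩ := hs
    have hcall : Eval (defs G ub hub) σ₀ σ (inPath (link (some a))) true ↔
        IsInPath G σ (linkVal σ a) s := by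
      rw [← ih hs]
      refine eval_call.trans ⟨?_, fun h => ⟨_, eval_link.2 rfl, h⟩⟩
      rintro ⟨x, hx, h⟩
      cases eval_link.1 hx
      exact h
    cases h : getFld σ .chk a <;>
      simp [inPathBody, eval_tnil, hcall, eval_tfld_mk, eval_tfld_chk, eval_tfld_l, eval_tfld_r,
        eval_tL, eval_tR, eval_explored, eval_nextNode, IsInPath, h, linkVal, and_assoc]

/-- The fields of nil are undefined, so a conjunct for nil is never true; hence `none ∉ s`. -/
theorem eval_outPath {e : Tm W U (Set (NPtr W))} :
    Eval (defs G ub hub) σ₀ σ (outPath e) true ↔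
      ∃ s, Eval (defs G ub hub) σ₀ σ e s ∧ none ∉ s ∧ ∀ a, some a ∈ s → IsOutPath G σ a := by
  refine eval_call.trans (exists_congr fun s => and_congr_right fun _ => ?_)
  change Eval (defs G ub hub) σ₀ σ (outPathBody G s) true ↔ _
  simp only [outPathBody, eval_all_true, eval_lit, exists_eq_left, Option.forall]
  refine and_congr ?_ (forall_congr' fun a => imp_congr_right fun _ => ?_)
  · simp [eval_tfld_l]
  · cases h : getFld σ .mk a <;>
      simp [eval_tfld_mk, eval_tfld_chk, eval_tfld_l, eval_tfld_r,
        eval_tL, eval_tR, eval_explored, IsOutPath, h]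

/-- The bridge from formulas to states. By uniqueness of values, the occurrences of `Stack(p)` in
the acyclicity and `OutPath` conjuncts denote one list, which also serves for `InPath`. -/
theorem holds_inv_iff {ρ : Formula W (sig W U)} : (inv G ρ).Holds (defs G ub hub) σ₀ σ ↔
    (ρ.outlying (.lit (MSet G))).Holds (defs G ub hub) σ₀ σ ∧ ∃ s, IsInv G σ s := by
  simp only [inv, Formula.holds_and, Formula.holds_tm, Formula.holds_eq]
  refine and_congr_right fun _ => ?_
  rw [eval_acyclic, eval_outPath]
  constructor
  · rintro ⟨⟨L, hL, hnd⟩, ⟨X, hX, hnil, hout⟩, hin, y, hy, hy'⟩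
    obtain ⟨s, hs, rfl⟩ := eval_stack.1 hL
    obtain ⟨L, hL', hX⟩ := eval_op.1 hX
    cases hL.unique hL'
    cases hX
    obtain ⟨x, hx, hin⟩ := eval_call.1 hin
    cases eval_tvar.1 hx
    obtain ⟨x, hx, rfl⟩ := eval_nextNode.1 hy
    cases eval_tvar.1 hx
    refine ⟨s, (eval_inPathBody hs).1 hin, hnd.of_map some, ?_, ?_, eval_tvar.1 hy'⟩
    -- The stack contains no nil, so nil in `NS₀` would remain in the set on which `OutPath`
    -- excludes it.
    · intro h
      exact hnil ⟨h, by simp⟩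
    · intro a ha has
      exact hout a ⟨ha, by simpa using has⟩
  · rintro ⟨s, hin, hnd, hnil, hout, hnext⟩
    have hL : Eval (defs G ub hub) σ₀ σ (stack (tvar .p)) (s.map some) :=
      eval_stack.2 ⟨s, hin.isStack, rfl⟩
    refine ⟨⟨_, hL, hnd.map (Option.some_injective _)⟩, ⟨_, .op hL rfl, fun h => hnil h.1, ?_⟩,
      .call (eval_tvar.2 rfl) ((eval_inPathBody hin.isStack).2 hin), _,
      eval_nextNode.2 ⟨_, eval_tvar.2 rfl, rfl⟩, eval_tvar.2 hnext⟩
    intro a ha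
    exact hout a ha.1 (by simpa using ha.2)

/-- Nil in `NS₀` would contribute an undefined conjunct. As `r₀` belongs to `NS₀`, a true
precondition forces `r₀` to be non-nil. -/
theorem holds_unmarked_iff : (unmarked G).Holds (defs G ub hub) σ₀ σ ↔ none ∉ G.NS₀ ∧
    ∀ a, some a ∈ G.NS₀ → getFld σ .mk a = false ∧ getFld σ .chk a = false ∧
      getFld σ .l a = G.L₀ a ∧ getFld σ .r a = G.R₀ a := by
  simp only [unmarked, Formula.holds_tm, eval_all_true, eval_lit, exists_eq_left, Option.forall]
  refine and_congr ?_ (forall_congr' fun a => imp_congr_right fun _ => ?_)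
  · simp [Term.neg, eval_tfld_mk]
  · simp [Term.neg, eval_tfld_mk, eval_tfld_chk, eval_tfld_l, eval_tfld_r, eval_tL, eval_tR]

theorem holds_marked_iff : (marked G).Holds (defs G ub hub) σ₀ σ ↔ none ∉ G.NS₀ ∧
    ∀ a, some a ∈ G.NS₀ → getFld σ .mk a = true ∧ getFld σ .chk a = true ∧
      getFld σ .l a = G.L₀ a ∧ getFld σ .r a = G.R₀ a := by
  simp only [marked, Formula.holds_tm, eval_all_true, eval_lit, exists_eq_left, Option.forall]
  refine and_congr ?_ (forall_congr' fun a => imp_congr_right fun _ => ?_)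
  · simp [eval_tfld_mk]
  · simp [eval_tfld_mk, eval_tfld_chk, eval_tfld_l, eval_tfld_r, eval_tL, eval_tR]

/-! ### The triples for initialisation, loop body and program. -/

variable {ρ : Formula W (sig W U)}

theorem inv_noPre (hρ : ρ.NoPre) : (inv G ρ).NoPre := by
  have := hρ.scope
  simp_all [inv, Formula.outlying, Formula.disjointScope, Formula.NoPre, Term.NoPre, acyclic,
    stack, tvar, outPath, inPath, nextNode]

theorem preCond_noPre (hρ : ρ.NoPre) : (preCond G ρ).NoPre := by
  have := hρ.scope
  simp_all [preCond, unmarked, Formula.outlying, Formula.disjointScope, Formula.NoPre,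
    Term.NoPre, Term.neg, Term.eqb, tL, tR, tfld, tvar]

theorem postCond_noPre (hρ : ρ.NoPre) : (postCond G ρ).NoPre := by
  simp [postCond, marked, Formula.NoPre, hρ, Term.NoPre, Term.eqb, tL, tR, tfld]

theorem entails_postCond : Entails (defs G ub hub)
    (.and (inv G ρ) (.not (.tm (condWh.toTerm _)))) (postCond G ρ) := by
  intro σ₀ σ h
  rw [Formula.holds_and, holds_inv_iff, Formula.holds_not_tm, Expr.eval_toTerm] at h
  obtain ⟨⟨hρ, s, hs⟩, hc⟩ := h
  obtain ⟨c, hc', hcond⟩ := eval_condWh σ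
  cases hc.symm.trans hc'
  obtain ⟨hp, ht⟩ := hcond.1 rfl
  rw [postCond, Formula.holds_and, holds_marked_iff]
  exact ⟨(Formula.holds_outlying.1 hρ).1, hs.nil_notMem, fun a ha => hs.marked_of_exit hp ht ha⟩

/-- The pre-state `σ₀` is arbitrary, so that pre-state terms in `ρ` can keep referring to the start
of the whole program. -/
theorem ensures_initCode_inv (h : (preCond G ρ).Holds (defs G ub hub) σ₀ σ) :
    initCode.Ensures σ fun σ' => (inv G ρ).Holds (defs G ub hub) σ₀ σ' := by
  rw [preCond, Formula.holds_and, Formula.holds_and, holds_unmarked_iff,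
    Formula.holds_eq] at h
  obtain ⟨hρ, ⟨x, hx, hr⟩, hnil, hG⟩ := h
  cases eval_lit.1 hr
  refine ensures_initCode (holds_inv_iff.2 ⟨hρ.outlying_congr ?_, [], ?_⟩)
  · exact agreeOff_putVar (agreeOff_putVar agreeOff_refl var_t_mem_mset) var_p_mem_mset
  · exact isInv_initCode hnil (eval_tvar.1 hx).symm fun a ha =>
      ⟨(hG a ha).1, (hG a ha).2.2⟩

theorem ensures_loopBody_inv (h : (inv G ρ).Holds (defs G ub hub) σ₀ σ)
    (hc : condWh.eval σ = some true) :
    loopBody.Ensures σ fun σ' => (inv G ρ).Holds (defs G ub hub) σ₀ σ' := by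
  obtain ⟨hρ, s, hs⟩ := holds_inv_iff.1 h
  exact (ensures_loopBody hs hc).mono fun σ' h =>
    holds_inv_iff.2 ⟨hρ.outlying_congr h.2, h.1⟩

theorem valid_initCode :
    Valid (defs G ub hub) (preCond G ρ) initCode (inv G ρ) :=
  fun _ h => ensures_initCode_inv h

theorem valid_loopBody : Valid (defs G ub hub)
    (.and (inv G ρ) (.tm (condWh.toTerm _))) loopBody (inv G ρ) := by
  intro σ h
  rw [Formula.holds_and, Formula.holds_tm, Expr.eval_toTerm] at h
  exact ensures_loopBody_inv h.1 h.2

theorem valid_program :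
    Valid (defs G ub hub) (preCond G ρ) program (postCond G ρ) := by
  intro σ h
  refine Stmt.ensures_seq ((ensures_initCode_inv h).mono fun σ₁ h₁ => ?_)
  -- The pre-state stays the initial `σ` through all iterations. Hence validity allows pre-state
  -- terms in `ρ`, although the rules for sequence and loop exclude them.
  refine (Stmt.ensures_while (I := fun σ' => (inv G ρ).Holds (defs G ub hub) σ σ')
    (fun σ' _ => (eval_condWh σ').imp fun _ h => h.1)
    (fun σ' h hc => ensures_loopBody_inv h hc) h₁).mono fun σ' h => ?_
  refine entails_postCond σ σ' ?_
  rw [Formula.holds_and, Formula.holds_not_tm, Expr.eval_toTerm]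
  exact h

end Specification

end SW

end ScopeLogic

theorem mainTheorem3 (W : ScopeLogic.World) (G : ScopeLogic.SW.Graph W)
    (U : ScopeLogic.FunSig)
    (ub : (f : U.Sym) → U.Dom f → ScopeLogic.SW.Tm W U (U.Cod f))
    (hub : ∀ f x, (ub f x).NoPre)
    (ρ : ScopeLogic.Formula W (ScopeLogic.SW.sig W U)) :
    -- the specification is valid, for every predicate `ρ`
    ScopeLogic.Valid (ScopeLogic.SW.defs G ub hub)
      (ScopeLogic.SW.preCond G ρ) ScopeLogic.SW.program (ScopeLogic.SW.postCond G ρ) ∧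
    -- it is derivable in the logic, and the loop is verified with the invariant `SW_INV`
    (ρ.NoPre →
      ScopeLogic.Provable (ScopeLogic.SW.defs G ub hub)
        (ScopeLogic.SW.preCond G ρ) ScopeLogic.SW.program (ScopeLogic.SW.postCond G ρ) ∧
      ScopeLogic.Provable (ScopeLogic.SW.defs G ub hub)
        (ScopeLogic.SW.preCond G ρ) ScopeLogic.SW.initCode (ScopeLogic.SW.inv G ρ) ∧
      ScopeLogic.Provable (ScopeLogic.SW.defs G ub hub)
        (.and (ScopeLogic.SW.inv G ρ) (.tm (ScopeLogic.SW.condWh.toTerm _)))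
        ScopeLogic.SW.loopBody (ScopeLogic.SW.inv G ρ) ∧
      ScopeLogic.Entails (ScopeLogic.SW.defs G ub hub)
        (.and (ScopeLogic.SW.inv G ρ) (.not (.tm (ScopeLogic.SW.condWh.toTerm _))))
        (ScopeLogic.SW.postCond G ρ)) := by
  refine ⟨ScopeLogic.SW.valid_program, fun hρ => ⟨?_, ?_, ?_, ScopeLogic.SW.entails_postCond⟩⟩
  · exact ScopeLogic.SW.valid_program.provable (ScopeLogic.SW.preCond_noPre hρ)
      (ScopeLogic.SW.postCond_noPre hρ)
  · exact ScopeLogic.SW.valid_initCode.provable (ScopeLogic.SW.preCond_noPre hρ)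
      (ScopeLogic.SW.inv_noPre hρ)
  · exact ScopeLogic.SW.valid_loopBody.provable
      ⟨ScopeLogic.SW.inv_noPre hρ, ScopeLogic.Expr.toTerm_noPre _⟩ (ScopeLogic.SW.inv_noPre hρ)
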